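/- A ranked alphabet $\Sigma$ is a finite set of symbols, each with a rank in $\mathbb{N}$; $T_\Sigma(X)$ is the set of terms over $\Sigma$ with variables in $X=\{x_1,x_2,\dots\}$, and $T_\Sigma$ is the set of ground terms. A term rewrite system (TRS) over $\Sigma$ is a finite set $R\subseteq T_\Sigma(X)\times T_\Sigma(X)$ of rules $l\to r$ such that every variable of $r$ occurs in $l$. For $L\subseteq T_\Sigma$ let $R^*_\Sigma(L)=\{p\in T_\Sigma : q\to_R^* p\text{ for some }q\in L\}$. The TRS $R$ is monadic if every left-hand side has height at least $1$ and every right-hand side has height at most $1$ (variables and constants have height $0$); it is right-ground if every right-hand side is ground; it is murg if it is the union of a monadic TRS and a right-ground TRS over $\Sigma$. The TRS $R$ over $\Sigma$ preserves $\Sigma$-recognizability of finite tree languages if for every finite $L\subseteq T_\Sigma$ the tree language $R^*_\Sigma(L)$ is recognizable, i.e. recognized by a (finite, nondeterministic) bottom-up tree automaton over $\Sigma$. Proposition. The following problem is undecidable. Instance: a ranked alphabet $\Sigma$ and a murg TRS $R$ over $\Sigma$ (given by the list of the ranks of the symbols of $\Sigma$ and a list of the rules of $R$, with terms written in prefix notation).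 Question: does $R$ preserve $\Sigma$-recognizability of finite tree languages? -/

import Mathlib

/-- A ranked alphabet: a finite set of symbols, each with a unique rank. Up to renaming, the
symbols are `0, …, size - 1`. -/
structure RankedAlphabet where
  size : ℕ
  rank : Fin size → ℕ

/-- `Term F V` is the set `T_F(V)` of terms (trees) over the ranked alphabet `F` with variables
in `V`. -/
inductive RankedAlphabet.Term (F : RankedAlphabet) (V : Type) : Type
  | var (x : V) : RankedAlphabet.Term F V
  | app (f : Fin F.size) (ts : Fin (F.rank f) → RankedAlphabet.Term F V) :
      RankedAlphabet.Term F V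

namespace RankedAlphabet

/-- The set of variables occurring in a term. -/
def Term.vars {F : RankedAlphabet} {V : Type} : F.Term V → Set V
  | .var x => {x}
  | .app _ ts => ⋃ i, (ts i).vars

/-- The height of a term; variables and constants have height `0`. -/
def Term.height {F : RankedAlphabet} {V : Type} : F.Term V → ℕ
  | .var _ => 0
  | .app _ ts => Finset.univ.sup fun i => (ts i).height + 1

/-- Simultaneous substitution of terms for variables. -/
def Term.subst {F : RankedAlphabet} {V W : Type} (σ : V → F.Term W) : F.Term V → F.Term W
  | .var x => σ x
  | .app f ts => .app f fun i => (ts i).subst σ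

/-- Ground terms, the elements of `T_F`. -/
abbrev GroundTerm (F : RankedAlphabet) : Type := F.Term Empty

/-- A pair `(l, r)` of terms over the fixed countable set of variables `x₀, x₁, …`. -/
abbrev Rule (F : RankedAlphabet) : Type := F.Term ℕ × F.Term ℕ

/-- A term rewrite system over `F`: a finite set of rules `(l, r)` such that each variable of `r`
occurs in `l`. -/
structure TRS (F : RankedAlphabet) where
  rules : Set F.Rule
  finite : rules.Finite
  vars_subset : ∀ ρ ∈ rules, ρ.2.vars ⊆ ρ.1.vars

/-- One rewrite step on `T_F(V)`: an instance `σ(l)` of a left-hand side, at some position, is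
replaced by `σ(r)`. -/
inductive TRS.Step {F : RankedAlphabet} (R : F.TRS) {V : Type} : F.Term V → F.Term V → Prop
  | root (ρ : F.Rule) (hρ : ρ ∈ R.rules) (σ : ℕ → F.Term V) :
      TRS.Step R (ρ.1.subst σ) (ρ.2.subst σ)
  | arg (f : Fin F.size) (ts : Fin (F.rank f) → F.Term V) (i : Fin (F.rank f)) (s : F.Term V)
      (h : TRS.Step R (ts i) s) :
      TRS.Step R (.app f ts) (.app f (Function.update ts i s))

/-- The set `R*(L)` of descendants of the trees in `L`. -/
def TRS.descendants {F : RankedAlphabet} (R : F.TRS) (L : Set F.GroundTerm) :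
    Set F.GroundTerm :=
  {p | ∃ q ∈ L, Relation.ReflTransGen R.Step q p}

/-- Each left-hand side has height at least `1`, each right-hand side height at most `1`. -/
def TRS.IsMonadic {F : RankedAlphabet} (R : F.TRS) : Prop :=
  ∀ ρ ∈ R.rules, 1 ≤ ρ.1.height ∧ ρ.2.height ≤ 1

/-- Each right-hand side is ground. -/
def TRS.IsRightGround {F : RankedAlphabet} (R : F.TRS) : Prop :=
  ∀ ρ ∈ R.rules, ρ.2.vars = ∅

/-- A murg TRS: the union of a monadic and a right-ground TRS over the same ranked alphabet. -/
def TRS.IsMurg {F : RankedAlphabet} (R : F.TRS) : Prop :=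
  ∃ M G : F.TRS, M.IsMonadic ∧ G.IsRightGround ∧ R.rules = M.rules ∪ G.rules

/-- A (nondeterministic) bottom-up tree automaton over `F` with set of states `A`:
`trans f q a` is the rule `f(q₁, …, qₙ) → a` and `eps a b` is the `λ`-rule `a → b`. -/
structure BTA (F : RankedAlphabet) (A : Type) where
  trans : (f : Fin F.size) → (Fin (F.rank f) → A) → A → Prop
  eps : A → A → Prop
  final : Set A

/-- `B.Reaches t a`: the automaton can evaluate the ground term `t` to the state `a`. -/
inductive BTA.Reaches {F : RankedAlphabet} {A : Type} (B : F.BTA A) : F.GroundTerm → A → Prop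
  | trans (f : Fin F.size) (ts : Fin (F.rank f) → F.GroundTerm) (q : Fin (F.rank f) → A) (a : A)
      (hq : ∀ i, BTA.Reaches B (ts i) (q i)) (h : B.trans f q a) :
      BTA.Reaches B (.app f ts) a
  | eps (t : F.GroundTerm) (a b : A) (ha : BTA.Reaches B t a) (h : B.eps a b) :
      BTA.Reaches B t b

/-- The tree language recognized by a bottom-up tree automaton. -/
def BTA.language {F : RankedAlphabet} {A : Type} (B : F.BTA A) : Set F.GroundTerm :=
  {t | ∃ a ∈ B.final, B.Reaches t a}

/-- A tree language is recognizable if a bottom-up tree automaton with finitely many states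
recognizes it. -/
def Recognizable {F : RankedAlphabet} (L : Set F.GroundTerm) : Prop :=
  ∃ (A : Type) (_ : Finite A) (B : F.BTA A), B.language = L

/-- `R` preserves `F`-recognizability of finite tree languages. -/
def TRS.PreservesFiniteRecognizability {F : RankedAlphabet} (R : F.TRS) : Prop :=
  ∀ L : Set F.GroundTerm, L.Finite → Recognizable (R.descendants L)

/-- Terms written as words in prefix notation: `Sum.inl x` stands for the variable `x` and
`Sum.inr f` for the symbol `f`. -/
def Term.code {F : RankedAlphabet} : F.Term ℕ → List (ℕ ⊕ ℕ)
  | .var x => [Sum.inl x]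
  | .app f ts => Sum.inr (f : ℕ) :: (List.ofFn fun i => (ts i).code).flatten

/-- The input presented to an algorithm: the list of the ranks of the symbols, and a list of
rules, each side of a rule being a word. -/
abbrev InstanceCode : Type := List ℕ × List (List (ℕ ⊕ ℕ) × List (ℕ ⊕ ℕ))

/-- The input that presents the ranked alphabet `F` together with the rules in `rs`. -/
def instanceCode (F : RankedAlphabet) (rs : List F.Rule) : InstanceCode :=
  (List.ofFn F.rank, rs.map fun ρ => (ρ.1.code, ρ.2.code))

end RankedAlphabet

/-! The halting problem is reduced to preservation. Let the steps of a machine be the instances of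
finitely many rules `ms`, with initial configuration `leaf`. The system guesses a history of the
machine, a list of successive configurations, in two copies, and verifies it. A right-hand side of
height 1 cannot rebuild the successor `r`, so `historyRule` compares `r` with the head of the first
copy and takes the new configuration and both new copies from the second. This is sound as long as
the copies agree: the nonlinear rule `start x x → check leaf x x` makes them agree, and the
right-hand side `check x y y` keeps it so. The copies grow from distinct generators `genL` and
`genR`; a tree that both can produce contains no generator, so copies that have passed the equality
test can no longer change.

A configuration matching `h` releases `flood`, which produces every ground term and absorbs the
`node`s around it. Moreover, every `start` or `check` term can restart as `start genL genR`. If the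
machine accepts, every tree containing `start`, `check` or `flood` therefore reaches `flood`. So a
finite `L` either has all trees as descendants or consists of trees over `leaf`, `node` and the
generators, whose descendants are recognizable (`preserves_of_accepts`). If it does not accept, the
descendants of `start genL genR` contain `check leaf (num m) (num n)` only for `m = n`, and contain
all of these diagonal trees, which no finite automaton can achieve (`accepts_of_preserves`).

The machine is an evaluator for `Turing.ToPartrec.Code` on binary trees (`accepts_iff_dom`), run on
one fixed code with noncomputable domain. The input `n` occurs in a single rule, so the instance is
primitive recursive in `n` (`primrec_instanceCode`). -/

namespace RankedAlphabet

/-! ### Substitution, rewriting below a symbol, runs of automata -/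

section Substitution

variable {F : RankedAlphabet} {U V W : Type}

theorem Term.subst_subst (τ : V → F.Term W) (σ : U → F.Term V) (t : F.Term U) :
    (t.subst σ).subst τ = t.subst fun x => (σ x).subst τ := by
  induction t with
  | var x => rfl
  | app f ts ih => simp only [Term.subst, ih]

theorem Term.vars_app (f : Fin F.size) (ts : Fin (F.rank f) → F.Term V) :
    (Term.app f ts).vars = ⋃ i, (ts i).vars := by
  simp only [Term.vars]

theorem Term.height_app (f : Fin F.size) (ts : Fin (F.rank f) → F.Term V) :
    (Term.app f ts).height = Finset.univ.sup fun i => (ts i).height + 1 := by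
  simp only [Term.height]

open Relation (ReflTransGen) in
theorem TRS.reach_app {R : F.TRS} {f : Fin F.size} {ts us : Fin (F.rank f) → F.Term V}
    (h : ∀ i, ReflTransGen R.Step (ts i) (us i)) :
    ReflTransGen R.Step (.app f ts) (.app f us) := by
  -- The arguments are rewritten one at a time; `s` collects those already done.
  suffices ∀ s : Finset (Fin (F.rank f)),
      ReflTransGen R.Step (.app f ts) (.app f (s.piecewise us ts)) by
    simpa using this Finset.univ
  intro s
  induction s using Finset.induction_on with
  | empty => simpa using ReflTransGen.refl
  | insert i s hi ih =>
    rw [Finset.piecewise_insert]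
    have hw : Function.update (s.piecewise us ts) i (ts i) = s.piecewise us ts := by
      rw [← Finset.piecewise_eq_of_notMem s us ts hi, Function.update_eq_self]
    refine ih.trans ?_
    nth_rw 1 [← hw]
    refine (h i).lift (fun x => Term.app f (Function.update (s.piecewise us ts) i x))
      fun x y hxy => ?_
    have := TRS.Step.arg f (Function.update (s.piecewise us ts) i x) i y (by simpa using hxy)
    rwa [Function.update_idem] at this

/-- An automaton sees an argument only through the states it can reach; this allows the exchange of
arguments in the pigeonhole argument. -/
theorem BTA.Reaches.congr_args {A : Type} {B : F.BTA A} {f : Fin F.size}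
    {ts ts' : Fin (F.rank f) → F.GroundTerm}
    (hts : ∀ i q, B.Reaches (ts i) q → B.Reaches (ts' i) q) {a : A}
    (h : B.Reaches (.app f ts) a) : B.Reaches (.app f ts') a := by
  generalize ht : Term.app f ts = t at h
  induction h with
  | trans g us q a hq htr _ =>
    cases ht
    exact .trans f ts' q a (fun i => hts i _ (hq i)) htr
  | eps t a b _ hab ih => exact .eps _ a b (ih ht) hab

end Substitution

/-- The alphabet of the reduction: binary trees over `leaf` and `node`, two generators of such
trees, a generator of all trees, and the two symbols `start` and `check`. -/
def verifier : RankedAlphabet := ⟨7, ![0, 0, 0, 0, 2, 2, 3]⟩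

/-! ### Terms over the fixed alphabet of the reduction -/

namespace verifier

variable {V W : Type}

def leaf : verifier.Term V := .app (0 : Fin 7) (![] : Fin 0 → _)
def genL : verifier.Term V := .app (1 : Fin 7) (![] : Fin 0 → _)
def genR : verifier.Term V := .app (2 : Fin 7) (![] : Fin 0 → _)
def flood : verifier.Term V := .app (3 : Fin 7) (![] : Fin 0 → _)
def node (s t : verifier.Term V) : verifier.Term V := .app (4 : Fin 7) (![s, t] : Fin 2 → _)
def start (s t : verifier.Term V) : verifier.Term V := .app (5 : Fin 7) (![s, t] : Fin 2 → _)
def check (s t u : verifier.Term V) : verifier.Term V :=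
  .app (6 : Fin 7) (![s, t, u] : Fin 3 → _)

@[elab_as_elim]
theorem term_induction {motive : verifier.Term V → Prop}
    (var : ∀ x, motive (.var x)) (leaf : motive leaf) (genL : motive genL) (genR : motive genR)
    (flood : motive flood)
    (node : ∀ s t, motive s → motive t → motive (node s t))
    (start : ∀ s t, motive s → motive t → motive (start s t))
    (check : ∀ s t u, motive s → motive t → motive u → motive (check s t u))
    (t : verifier.Term V) : motive t := by
  induction t with
  | var x => exact var x
  | app f ts ih =>
    change Fin 7 at f
    have h0 : ∀ g : Fin 0 → verifier.Term V, g = ![] := fun g => by ext i; exact i.elim0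
    have h2 : ∀ g : Fin 2 → verifier.Term V, g = ![g 0, g 1] := fun g => by
      funext i; fin_cases i <;> rfl
    have h3 : ∀ g : Fin 3 → verifier.Term V, g = ![g 0, g 1, g 2] := fun g => by
      funext i; fin_cases i <;> rfl
    match f, ts, ih with
    | 0, ts, _ => rw [h0 ts]; exact leaf
    | 1, ts, _ => rw [h0 ts]; exact genL
    | 2, ts, _ => rw [h0 ts]; exact genR
    | 3, ts, _ => rw [h0 ts]; exact flood
    | 4, ts, ih => rw [h2 ts]; exact node _ _ (ih (0 : Fin 2)) (ih (1 : Fin 2))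
    | 5, ts, ih => rw [h2 ts]; exact start _ _ (ih (0 : Fin 2)) (ih (1 : Fin 2))
    | 6, ts, ih =>
      rw [h3 ts]; exact check _ _ _ (ih (0 : Fin 3)) (ih (1 : Fin 3)) (ih (2 : Fin 3))

/-- The index of the root symbol; variables get a value that no symbol has. -/
def head : verifier.Term V → ℕ
  | .var _ => 7
  | .app f _ => f.val

@[simp] theorem head_leaf : head (leaf : verifier.Term V) = 0 := rfl
@[simp] theorem head_genL : head (genL : verifier.Term V) = 1 := rfl
@[simp] theorem head_genR : head (genR : verifier.Term V) = 2 := rfl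
@[simp] theorem head_flood : head (flood : verifier.Term V) = 3 := rfl
@[simp] theorem head_node (s t : verifier.Term V) : head (node s t) = 4 := rfl
@[simp] theorem head_start (s t : verifier.Term V) : head (start s t) = 5 := rfl
@[simp] theorem head_check (s t u : verifier.Term V) : head (check s t u) = 6 := rfl

theorem ne_of_head {s t : verifier.Term V} (h : head s ≠ head t) : s ≠ t :=
  fun e => h (congrArg head e)

@[simp] theorem node_inj {s t s' t' : verifier.Term V} :
    node s t = node s' t' ↔ s = s' ∧ t = t' := by
  refine ⟨fun h => ?_, fun h => by rw [h.1, h.2]⟩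
  have h := eq_of_heq (Term.app.inj h).2
  exact ⟨congrFun h (0 : Fin 2), congrFun h (1 : Fin 2)⟩

@[simp] theorem start_inj {s t s' t' : verifier.Term V} :
    start s t = start s' t' ↔ s = s' ∧ t = t' := by
  refine ⟨fun h => ?_, fun h => by rw [h.1, h.2]⟩
  have h := eq_of_heq (Term.app.inj h).2
  exact ⟨congrFun h (0 : Fin 2), congrFun h (1 : Fin 2)⟩

@[simp] theorem check_inj {s t u s' t' u' : verifier.Term V} :
    check s t u = check s' t' u' ↔ s = s' ∧ t = t' ∧ u = u' := by
  refine ⟨fun h => ?_, fun h => by rw [h.1, h.2.1, h.2.2]⟩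
  have h := eq_of_heq (Term.app.inj h).2
  exact ⟨congrFun h (0 : Fin 3), congrFun h (1 : Fin 3), congrFun h (2 : Fin 3)⟩

@[simp] theorem leaf_ne_node (s t : verifier.Term V) : leaf ≠ node s t :=
  ne_of_head (by simp)
@[simp] theorem node_ne_leaf (s t : verifier.Term V) : node s t ≠ leaf :=
  ne_of_head (by simp)

section Subst

variable (σ : V → verifier.Term W)

@[simp] theorem subst_var (x : V) : Term.subst σ (.var x : verifier.Term V) = σ x := rfl
@[simp] theorem subst_leaf : Term.subst σ (leaf : verifier.Term V) = leaf :=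
  congrArg (Term.app _) (funext fun i : Fin 0 => i.elim0)
@[simp] theorem subst_genL : Term.subst σ (genL : verifier.Term V) = genL :=
  congrArg (Term.app _) (funext fun i : Fin 0 => i.elim0)
@[simp] theorem subst_genR : Term.subst σ (genR : verifier.Term V) = genR :=
  congrArg (Term.app _) (funext fun i : Fin 0 => i.elim0)
@[simp] theorem subst_flood : Term.subst σ (flood : verifier.Term V) = flood :=
  congrArg (Term.app _) (funext fun i : Fin 0 => i.elim0)
@[simp] theorem subst_node (s t : verifier.Term V) :
    Term.subst σ (node s t) = node (s.subst σ) (t.subst σ) :=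
  congrArg (Term.app _) (funext fun i : Fin 2 => by fin_cases i <;> rfl)
@[simp] theorem subst_start (s t : verifier.Term V) :
    Term.subst σ (start s t) = start (s.subst σ) (t.subst σ) :=
  congrArg (Term.app _) (funext fun i : Fin 2 => by fin_cases i <;> rfl)
@[simp] theorem subst_check (s t u : verifier.Term V) :
    Term.subst σ (check s t u) = check (s.subst σ) (t.subst σ) (u.subst σ) :=
  congrArg (Term.app _) (funext fun i : Fin 3 => by fin_cases i <;> rfl)

end Subst

section Vars

@[simp] theorem vars_var (x : V) : (Term.var x : verifier.Term V).vars = {x} := by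
  simp [Term.vars]
@[simp] theorem vars_leaf : (leaf : verifier.Term V).vars = ∅ := by
  rw [leaf]; exact (Term.vars_app _ _).trans (Set.iUnion_of_empty (ι := Fin 0) _)
@[simp] theorem vars_genL : (genL : verifier.Term V).vars = ∅ := by
  rw [genL]; exact (Term.vars_app _ _).trans (Set.iUnion_of_empty (ι := Fin 0) _)
@[simp] theorem vars_genR : (genR : verifier.Term V).vars = ∅ := by
  rw [genR]; exact (Term.vars_app _ _).trans (Set.iUnion_of_empty (ι := Fin 0) _)
@[simp] theorem vars_flood : (flood : verifier.Term V).vars = ∅ := by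
  rw [flood]; exact (Term.vars_app _ _).trans (Set.iUnion_of_empty (ι := Fin 0) _)
@[simp] theorem vars_node (s t : verifier.Term V) : (node s t).vars = s.vars ∪ t.vars := by
  refine (Term.vars_app _ _).trans ?_
  ext x
  exact Set.mem_iUnion.trans (Fin.exists_fin_two (p := fun i => x ∈ (![s, t] i).vars))
@[simp] theorem vars_start (s t : verifier.Term V) : (start s t).vars = s.vars ∪ t.vars := by
  refine (Term.vars_app _ _).trans ?_
  ext x
  exact Set.mem_iUnion.trans (Fin.exists_fin_two (p := fun i => x ∈ (![s, t] i).vars))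
@[simp] theorem vars_check (s t u : verifier.Term V) :
    (check s t u).vars = s.vars ∪ (t.vars ∪ u.vars) := by
  refine (Term.vars_app _ _).trans ?_
  ext x
  refine Set.mem_iUnion.trans ((Fin.exists_fin_succ (P := fun i : Fin 3 =>
    x ∈ (![s, t, u] i).vars)).trans (or_congr Iff.rfl ?_))
  exact Fin.exists_fin_two (p := fun i => x ∈ (![t, u] i).vars)

end Vars

section Height

theorem one_le_height_start (s t : verifier.Term V) : 1 ≤ (start s t).height := by
  refine (Term.height_app _ _).ge.trans' ?_
  exact le_trans (Nat.le_add_left 1 _) (Finset.le_sup (f := fun i : Fin 2 =>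
    (![s, t] i).height + 1) (Finset.mem_univ 0))

theorem one_le_height_check (s t u : verifier.Term V) : 1 ≤ (check s t u).height := by
  refine (Term.height_app _ _).ge.trans' ?_
  exact le_trans (Nat.le_add_left 1 _) (Finset.le_sup (f := fun i : Fin 3 =>
    (![s, t, u] i).height + 1) (Finset.mem_univ 0))

@[simp] theorem height_leaf : (leaf : verifier.Term V).height = 0 := by
  refine (Term.height_app _ _).trans ?_
  rfl

theorem height_check_le_one {s t u : verifier.Term V} (hs : s.height = 0) (ht : t.height = 0)
    (hu : u.height = 0) : (check s t u).height ≤ 1 := by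
  refine (Term.height_app _ _).trans_le ?_
  refine Finset.sup_le fun i _ => ?_
  change (![s, t, u] i).height + 1 ≤ 1
  change Fin 3 at i
  fin_cases i
  · exact Nat.add_le_add_right hs.le 1
  · exact Nat.add_le_add_right ht.le 1
  · exact Nat.add_le_add_right hu.le 1

end Height

/-! ### Rewrite steps by position -/

section Steps

variable {R : verifier.TRS}

/-- A rewrite step at the root. -/
def RootStep (R : verifier.TRS) (t u : verifier.Term V) : Prop :=
  ∃ ρ ∈ R.rules, ∃ σ : ℕ → verifier.Term V, ρ.1.subst σ = t ∧ ρ.2.subst σ = u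

theorem RootStep.step {t u : verifier.Term V} (h : RootStep R t u) : R.Step t u := by
  obtain ⟨ρ, hρ, σ, rfl, rfl⟩ := h
  exact .root ρ hρ σ

theorem step_app {f : Fin verifier.size} {ts : Fin (verifier.rank f) → verifier.Term V}
    {u : verifier.Term V} (h : R.Step (.app f ts) u) :
    RootStep R (.app f ts) u ∨
      ∃ i s, R.Step (ts i) s ∧ u = .app f (Function.update ts i s) := by
  generalize ht : Term.app f ts = t at h
  cases h with
  | root ρ hρ σ => exact .inl ⟨ρ, hρ, σ, rfl, rfl⟩
  | arg g us i s hs => cases ht; exact .inr ⟨i, s, hs, rfl⟩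

theorem step_leaf {u : verifier.Term V} (h : R.Step leaf u) : RootStep R leaf u :=
  (step_app h).resolve_right fun ⟨i, _⟩ => (show Fin 0 from i).elim0
theorem step_genL {u : verifier.Term V} (h : R.Step genL u) : RootStep R genL u :=
  (step_app h).resolve_right fun ⟨i, _⟩ => (show Fin 0 from i).elim0
theorem step_genR {u : verifier.Term V} (h : R.Step genR u) : RootStep R genR u :=
  (step_app h).resolve_right fun ⟨i, _⟩ => (show Fin 0 from i).elim0

theorem update_two (s t s' : V) : Function.update ![s, t] 0 s' = ![s', t] ∧
    Function.update ![s, t] 1 s' = ![s, s'] := by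
  constructor <;> (funext i; fin_cases i <;> simp)

theorem update_three (s t u s' : V) : Function.update ![s, t, u] 0 s' = ![s', t, u] ∧
    Function.update ![s, t, u] 1 s' = ![s, s', u] ∧
    Function.update ![s, t, u] 2 s' = ![s, t, s'] := by
  refine ⟨?_, ?_, ?_⟩ <;> (funext i; fin_cases i <;> simp)

theorem step_node {s t u : verifier.Term V} (h : R.Step (node s t) u) :
    RootStep R (node s t) u ∨ (∃ s', R.Step s s' ∧ u = node s' t) ∨
      ∃ t', R.Step t t' ∧ u = node s t' := by
  refine (step_app h).imp_right fun ⟨i, v, hv, hu⟩ => ?_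
  change Fin 2 at i
  match i, hv, hu with
  | 0, hv, hu => exact .inl ⟨v, hv, hu.trans (congrArg (Term.app _) (update_two s t v).1)⟩
  | 1, hv, hu => exact .inr ⟨v, hv, hu.trans (congrArg (Term.app _) (update_two s t v).2)⟩

theorem step_start {s t u : verifier.Term V} (h : R.Step (start s t) u) :
    RootStep R (start s t) u ∨ (∃ s', R.Step s s' ∧ u = start s' t) ∨
      ∃ t', R.Step t t' ∧ u = start s t' := by
  refine (step_app h).imp_right fun ⟨i, v, hv, hu⟩ => ?_
  change Fin 2 at i
  match i, hv, hu with
  | 0, hv, hu => exact .inl ⟨v, hv, hu.trans (congrArg (Term.app _) (update_two s t v).1)⟩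
  | 1, hv, hu => exact .inr ⟨v, hv, hu.trans (congrArg (Term.app _) (update_two s t v).2)⟩

theorem step_check {s t u v : verifier.Term V} (h : R.Step (check s t u) v) :
    RootStep R (check s t u) v ∨ (∃ s', R.Step s s' ∧ v = check s' t u) ∨
      (∃ t', R.Step t t' ∧ v = check s t' u) ∨ ∃ u', R.Step u u' ∧ v = check s t u' := by
  refine (step_app h).imp_right fun ⟨i, w, hw, hv⟩ => ?_
  change Fin 3 at i
  match i, hw, hv with
  | 0, hw, hv =>
    exact .inl ⟨w, hw, hv.trans (congrArg (Term.app _) (update_three s t u w).1)⟩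
  | 1, hw, hv =>
    exact .inr (.inl ⟨w, hw, hv.trans (congrArg (Term.app _) (update_three s t u w).2.1)⟩)
  | 2, hw, hv =>
    exact .inr (.inr ⟨w, hw, hv.trans (congrArg (Term.app _) (update_three s t u w).2.2)⟩)

open Relation (ReflTransGen)

theorem reach_node {s s' t t' : verifier.Term V} (hs : ReflTransGen R.Step s s')
    (ht : ReflTransGen R.Step t t') : ReflTransGen R.Step (node s t) (node s' t') :=
  TRS.reach_app (Fin.forall_fin_two.2 ⟨hs, ht⟩)

theorem reach_start {s s' t t' : verifier.Term V} (hs : ReflTransGen R.Step s s')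
    (ht : ReflTransGen R.Step t t') : ReflTransGen R.Step (start s t) (start s' t') :=
  TRS.reach_app (Fin.forall_fin_two.2 ⟨hs, ht⟩)

theorem reach_check {s s' t t' u u' : verifier.Term V} (hs : ReflTransGen R.Step s s')
    (ht : ReflTransGen R.Step t t') (hu : ReflTransGen R.Step u u') :
    ReflTransGen R.Step (check s t u) (check s' t' u') :=
  TRS.reach_app (Fin.forall_fin_succ.2 ⟨hs, Fin.forall_fin_two.2 ⟨ht, hu⟩⟩)

end Steps

/-! ### The rewrite system that verifies histories -/

open Relation (ReflTransGen)

/-- Renames the variables so that `x₀`, `x₁`, `x₂` do not occur. -/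
def shift (t : verifier.Term ℕ) : verifier.Term ℕ := t.subst fun i => .var (i + 3)

theorem subst_shift {V : Type} (σ : ℕ → verifier.Term V) (t : verifier.Term ℕ) :
    (shift t).subst σ = t.subst fun i => σ (i + 3) :=
  Term.subst_subst _ _ _

/-- `check t (node r z) (node x y) → check x y y` whenever `t → r` is an instance of `ρ`: the
current configuration `t` has the successor `r` at the front of the remaining history. -/
def historyRule (ρ : verifier.Rule) : verifier.Rule :=
  (check (shift ρ.1) (node (shift ρ.2) (.var 0)) (node (.var 1) (.var 2)),
    check (.var 1) (.var 2) (.var 2))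

/-- The initial configuration is the constant `leaf`, since below `check` a right-hand side of
height 1 has room only for constants and variables. -/
def monadicRules (ms : List verifier.Rule) : List verifier.Rule :=
  (start (.var 0) (.var 0), check leaf (.var 0) (.var 0)) :: ms.map historyRule

/-- In order: growth of the two generators, production of arbitrary terms by `flood`, absorption of
`node`s by `flood`, restarts, and the release of `flood` on acceptance. -/
def rightGroundRules (h : verifier.Term ℕ) : List verifier.Rule :=
  [(genL, leaf), (genL, node genL genL), (genR, leaf), (genR, node genR genR),
   (flood, leaf), (flood, genL), (flood, genR), (flood, node flood flood),
   (flood, start flood flood), (flood, check flood flood flood),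
   (node flood (.var 0), flood), (node (.var 0) flood, flood),
   (start (.var 0) (.var 1), start genL genR),
   (check (.var 0) (.var 1) (.var 2), start genL genR),
   (check (shift h) (.var 0) (.var 1), flood)]

def monadicPart (ms : List verifier.Rule) : verifier.TRS where
  rules := {ρ | ρ ∈ monadicRules ms}
  finite := List.finite_toSet _
  vars_subset ρ hρ := by
    simp only [monadicRules, List.mem_cons, List.mem_map, Set.mem_ofPred_eq] at hρ
    rcases hρ with rfl | ⟨ρ, -, rfl⟩
    · simp
    · intro x
      simp only [historyRule, vars_check, vars_node, vars_var, Set.mem_union]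
      tauto

theorem vars_of_mem_rightGroundRules {h : verifier.Term ℕ} {ρ : verifier.Rule}
    (hρ : ρ ∈ rightGroundRules h) : ρ.2.vars = ∅ := by
  simp only [rightGroundRules, List.mem_cons, List.not_mem_nil, or_false] at hρ
  rcases hρ with rfl | rfl | rfl | rfl | rfl | rfl | rfl | rfl | rfl | rfl | rfl | rfl | rfl |
    rfl | rfl <;> simp

def rightGroundPart (h : verifier.Term ℕ) : verifier.TRS where
  rules := {ρ | ρ ∈ rightGroundRules h}
  finite := List.finite_toSet _
  vars_subset ρ hρ := by rw [vars_of_mem_rightGroundRules hρ]; exact Set.empty_subset _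

def systemRules (ms : List verifier.Rule) (h : verifier.Term ℕ) : List verifier.Rule :=
  monadicRules ms ++ rightGroundRules h

def system (ms : List verifier.Rule) (h : verifier.Term ℕ) : verifier.TRS where
  rules := {ρ | ρ ∈ systemRules ms h}
  finite := List.finite_toSet _
  vars_subset ρ hρ := (List.mem_append.1 hρ).elim ((monadicPart ms).vars_subset ρ)
    ((rightGroundPart h).vars_subset ρ)

theorem system_isMurg (ms : List verifier.Rule) (h : verifier.Term ℕ) :
    (system ms h).IsMurg := by
  refine ⟨monadicPart ms, rightGroundPart h, fun ρ hρ => ?_,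
    fun ρ hρ => vars_of_mem_rightGroundRules hρ, Set.ext fun ρ => List.mem_append⟩
  simp only [monadicPart, monadicRules, List.mem_cons, List.mem_map, Set.mem_ofPred_eq] at hρ
  rcases hρ with rfl | ⟨ρ, -, rfl⟩
  · exact ⟨one_le_height_start _ _, height_check_le_one height_leaf rfl rfl⟩
  · exact ⟨one_le_height_check _ _ _, height_check_le_one rfl rfl rfl⟩

/-! ### The redexes of the system -/

section RootSteps

variable {V : Type} {ms : List verifier.Rule} {h : verifier.Term ℕ}

/-- The results of rewriting `flood` are not recorded: the invariants below exclude the redex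
`flood` itself. -/
theorem rootStep_system {t u : verifier.Term V} (ht : RootStep (system ms h) t u) :
    (∃ s, t = start s s ∧ u = check leaf s s) ∨
    (∃ ρ ∈ ms, ∃ σ : ℕ → verifier.Term V, ∃ x y z,
      t = check (ρ.1.subst σ) (node (ρ.2.subst σ) z) (node x y) ∧ u = check x y y) ∨
    (t = genL ∧ (u = leaf ∨ u = node genL genL)) ∨
    (t = genR ∧ (u = leaf ∨ u = node genR genR)) ∨
    t = flood ∨
    (∃ s, (t = node flood s ∨ t = node s flood) ∧ u = flood) ∨
    (∃ r s, t = start r s ∧ u = start genL genR) ∨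
    (∃ r s s', t = check r s s' ∧ u = start genL genR) ∨
    (∃ (σ : ℕ → verifier.Term V) (s s' : _), t = check (h.subst σ) s s' ∧ u = flood) := by
  obtain ⟨ρ, hρ, σ, rfl, rfl⟩ := ht
  rcases List.mem_append.1 hρ with hρ | hρ
  · simp only [monadicRules, List.mem_cons, List.mem_map] at hρ
    rcases hρ with rfl | ⟨ρ, hm, rfl⟩
    · exact .inl ⟨σ 0, by simp⟩
    · exact .inr (.inl ⟨ρ, hm, fun i => σ (i + 3), σ 1, σ 2, σ 0, by
        simp [historyRule, subst_shift]⟩)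
  · simp only [rightGroundRules, List.mem_cons, List.not_mem_nil, or_false] at hρ
    rcases hρ with rfl | rfl | rfl | rfl | rfl | rfl | rfl | rfl | rfl | rfl | rfl | rfl | rfl |
      rfl | rfl
    iterate 2 exact .inr (.inr (.inl (by simp)))
    iterate 2 exact .inr (.inr (.inr (.inl (by simp))))
    iterate 6 exact .inr (.inr (.inr (.inr (.inl (by simp)))))
    iterate 2 exact .inr (.inr (.inr (.inr (.inr (.inl ⟨σ 0, by simp⟩)))))
    · exact .inr (.inr (.inr (.inr (.inr (.inr (.inl ⟨σ 0, σ 1, by simp⟩))))))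
    · exact .inr (.inr (.inr (.inr (.inr (.inr (.inr (.inl ⟨σ 0, σ 1, σ 2, by simp⟩)))))))
    · exact .inr (.inr (.inr (.inr (.inr (.inr (.inr (.inr
        ⟨fun i => σ (i + 3), σ 0, σ 1, by simp [subst_shift]⟩)))))))

theorem not_rootStep_leaf {u : verifier.Term V} : ¬ RootStep (system ms h) leaf u := by
  intro ht
  rcases rootStep_system ht with ⟨_, e, -⟩ | ⟨_, -, _, _, _, _, e, -⟩ | ⟨e, -⟩ | ⟨e, -⟩ | e |
    ⟨_, e | e, -⟩ | ⟨_, _, e, -⟩ | ⟨_, _, _, e, -⟩ | ⟨_, _, _, e, -⟩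
  all_goals exact absurd (congrArg head e) (by simp)

theorem rootStep_genL {u : verifier.Term V} (ht : RootStep (system ms h) genL u) :
    u = leaf ∨ u = node genL genL := by
  rcases rootStep_system ht with ⟨_, e, -⟩ | ⟨_, -, _, _, _, _, e, -⟩ | ⟨-, e⟩ | ⟨e, -⟩ | e |
    ⟨_, e | e, -⟩ | ⟨_, _, e, -⟩ | ⟨_, _, _, e, -⟩ | ⟨_, _, _, e, -⟩
  case inr.inr.inl => exact e
  all_goals exact absurd (congrArg head e) (by simp)

theorem rootStep_genR {u : verifier.Term V} (ht : RootStep (system ms h) genR u) :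
    u = leaf ∨ u = node genR genR := by
  rcases rootStep_system ht with ⟨_, e, -⟩ | ⟨_, -, _, _, _, _, e, -⟩ | ⟨e, -⟩ | ⟨-, e⟩ | e |
    ⟨_, e | e, -⟩ | ⟨_, _, e, -⟩ | ⟨_, _, _, e, -⟩ | ⟨_, _, _, e, -⟩
  case inr.inr.inr.inl => exact e
  all_goals exact absurd (congrArg head e) (by simp)

theorem rootStep_node {s t u : verifier.Term V} (ht : RootStep (system ms h) (node s t) u) :
    s = flood ∨ t = flood := by
  rcases rootStep_system ht with ⟨_, e, -⟩ | ⟨_, -, _, _, _, _, e, -⟩ | ⟨e, -⟩ | ⟨e, -⟩ | e |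
    ⟨_, e | e, -⟩ | ⟨_, _, e, -⟩ | ⟨_, _, _, e, -⟩ | ⟨_, _, _, e, -⟩
  case inr.inr.inr.inr.inr.inl.inl => exact .inl (node_inj.1 e).1
  case inr.inr.inr.inr.inr.inl.inr => exact .inr (node_inj.1 e).2
  all_goals exact absurd (congrArg head e) (by simp)

theorem rootStep_start {s t u : verifier.Term V} (ht : RootStep (system ms h) (start s t) u) :
    (s = t ∧ u = check leaf s s) ∨ u = start genL genR := by
  rcases rootStep_system ht with ⟨_, e, e'⟩ | ⟨_, -, _, _, _, _, e, -⟩ | ⟨e, -⟩ | ⟨e, -⟩ | e |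
    ⟨_, e | e, -⟩ | ⟨_, _, -, e⟩ | ⟨_, _, _, e, -⟩ | ⟨_, _, _, e, -⟩
  case inl =>
    obtain ⟨rfl, rfl⟩ := start_inj.1 e
    exact .inl ⟨rfl, e'⟩
  case inr.inr.inr.inr.inr.inr.inl => exact .inr e
  all_goals exact absurd (congrArg head e) (by simp)

theorem rootStep_check {r s t u : verifier.Term V}
    (ht : RootStep (system ms h) (check r s t) u) :
    (∃ ρ ∈ ms, ∃ σ : ℕ → verifier.Term V, ∃ x y z, r = ρ.1.subst σ ∧
      s = node (ρ.2.subst σ) z ∧ t = node x y ∧ u = check x y y) ∨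
    u = start genL genR ∨ ∃ σ : ℕ → verifier.Term V, r = h.subst σ := by
  rcases rootStep_system ht with ⟨_, e, -⟩ | ⟨ρ, hρ, σ, x, y, z, e, e'⟩ | ⟨e, -⟩ | ⟨e, -⟩ | e |
    ⟨_, e | e, -⟩ | ⟨_, _, e, -⟩ | ⟨_, _, _, -, e⟩ | ⟨σ, _, _, e, -⟩
  case inr.inl =>
    obtain ⟨rfl, rfl, rfl⟩ := check_inj.1 e
    exact .inl ⟨ρ, hρ, σ, x, y, z, rfl, rfl, rfl, e'⟩
  case inr.inr.inr.inr.inr.inr.inr.inl => exact .inr (.inl e)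
  case inr.inr.inr.inr.inr.inr.inr.inr => exact .inr (.inr ⟨σ, (check_inj.1 e).1⟩)
  all_goals exact absurd (congrArg head e) (by simp)

/-- A rule of the list applies at the root. -/
theorem step_of_mem {l r : verifier.Term ℕ} (hρ : (l, r) ∈ systemRules ms h)
    (σ : ℕ → verifier.Term V) {t u : verifier.Term V} (ht : l.subst σ = t) (hu : r.subst σ = u) :
    (system ms h).Step t u :=
  RootStep.step ⟨(l, r), hρ, σ, ht, hu⟩

theorem step_of_mem_rightGround {l r : verifier.Term ℕ} (hρ : (l, r) ∈ rightGroundRules h)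
    (σ : ℕ → verifier.Term V) {t u : verifier.Term V} (ht : l.subst σ = t) (hu : r.subst σ = u) :
    (system ms h).Step t u :=
  step_of_mem (List.mem_append_right _ hρ) σ ht hu

theorem step_start_check (t : verifier.Term V) :
    (system ms h).Step (start t t) (check leaf t t) :=
  step_of_mem (List.mem_append_left _ (List.mem_cons_self ..)) (fun _ => t) (by simp) (by simp)

theorem step_start_restart (s t : verifier.Term V) :
    (system ms h).Step (start s t) (start genL genR) :=
  step_of_mem_rightGround (l := start (.var 0) (.var 1)) (r := start genL genR)
    (by simp [rightGroundRules]) (fun i => if i = 0 then s else t) (by simp) (by simp)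

theorem step_check_restart (s t u : verifier.Term V) :
    (system ms h).Step (check s t u) (start genL genR) :=
  step_of_mem_rightGround (l := check (.var 0) (.var 1) (.var 2)) (r := start genL genR)
    (by simp [rightGroundRules]) (fun i => if i = 0 then s else if i = 1 then t else u)
    (by simp) (by simp)

theorem step_check_flood (σ : ℕ → verifier.Term V) (s t : verifier.Term V) :
    (system ms h).Step (check (h.subst σ) s t) flood :=
  step_of_mem_rightGround (l := check (shift h) (.var 0) (.var 1)) (r := flood)
    (by simp [rightGroundRules])
    -- Index `2` does not occur in this rule, so its value is arbitrary.
    (fun | 0 => s | 1 => t | 2 => t | i + 3 => σ i) (by simp [subst_shift]) (by simp)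

theorem step_check_check {ρ : verifier.Rule} (hρ : ρ ∈ ms) (σ : ℕ → verifier.Term V)
    (x y z : verifier.Term V) :
    (system ms h).Step (check (ρ.1.subst σ) (node (ρ.2.subst σ) z) (node x y))
      (check x y y) :=
  step_of_mem (l := (historyRule ρ).1) (r := (historyRule ρ).2)
    (List.mem_append_left _ (List.mem_cons_of_mem _ (List.mem_map_of_mem hρ)))
    (fun | 0 => z | 1 => x | 2 => y | i + 3 => σ i)
    (by simp [historyRule, subst_shift]) (by simp [historyRule])

theorem step_genL_leaf : (system ms h).Step (genL : verifier.Term V) leaf :=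
  step_of_mem_rightGround (l := genL) (r := leaf) (by simp [rightGroundRules])
    (fun _ => leaf) (by simp) (by simp)

theorem step_genL_node : (system ms h).Step (genL : verifier.Term V) (node genL genL) :=
  step_of_mem_rightGround (l := genL) (r := node genL genL) (by simp [rightGroundRules])
    (fun _ => leaf) (by simp) (by simp)

theorem step_genR_leaf : (system ms h).Step (genR : verifier.Term V) leaf :=
  step_of_mem_rightGround (l := genR) (r := leaf) (by simp [rightGroundRules])
    (fun _ => leaf) (by simp) (by simp)

theorem step_genR_node : (system ms h).Step (genR : verifier.Term V) (node genR genR) :=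
  step_of_mem_rightGround (l := genR) (r := node genR genR) (by simp [rightGroundRules])
    (fun _ => leaf) (by simp) (by simp)

theorem step_node_flood (t : verifier.Term V) :
    (system ms h).Step (node flood t) flood ∧ (system ms h).Step (node t flood) flood :=
  ⟨step_of_mem_rightGround (l := node flood (.var 0)) (r := flood)
    (by simp [rightGroundRules]) (fun _ => t) (by simp) (by simp),
  step_of_mem_rightGround (l := node (.var 0) flood) (r := flood)
    (by simp [rightGroundRules]) (fun _ => t) (by simp) (by simp)⟩

theorem step_flood {r : verifier.Term ℕ} (hr : (flood, r) ∈ rightGroundRules h)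
    {u : verifier.Term V} (hu : r.subst (fun _ => leaf) = u) : (system ms h).Step flood u :=
  step_of_mem_rightGround hr (fun _ => leaf) (by simp) hu

end RootSteps

/-! ### Accepting runs release `flood` -/

variable {ms : List verifier.Rule} {h : verifier.Term ℕ}

theorem flood_reach (t : verifier.GroundTerm) : ReflTransGen (system ms h).Step flood t := by
  induction t using term_induction with
  | var x => exact x.elim
  | leaf => exact .single (step_flood (r := leaf) (by simp [rightGroundRules]) (by simp))
  | genL => exact .single (step_flood (r := genL) (by simp [rightGroundRules]) (by simp))
  | genR => exact .single (step_flood (r := genR) (by simp [rightGroundRules]) (by simp))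
  | flood => exact .refl
  | node s t hs ht =>
    exact .head (step_flood (r := node flood flood) (u := node flood flood)
      (by simp [rightGroundRules]) (by simp)) (reach_node hs ht)
  | start s t hs ht =>
    exact .head (step_flood (r := start flood flood) (u := start flood flood)
      (by simp [rightGroundRules]) (by simp)) (reach_start hs ht)
  | check s t u hs ht hu =>
    exact .head (step_flood (r := check flood flood flood) (u := check flood flood flood)
      (by simp [rightGroundRules]) (by simp)) (reach_check hs ht hu)

/-- Binary trees over `leaf` and `node` with further leaves from `S`. -/
inductive TreeOver (S : Set verifier.GroundTerm) : verifier.GroundTerm → Prop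
  | leaf : TreeOver S leaf
  | mem {t} (ht : t ∈ S) : TreeOver S t
  | node {s t} (hs : TreeOver S s) (ht : TreeOver S t) : TreeOver S (node s t)

/-- Binary trees over `leaf` and `node`. -/
abbrev Plain : verifier.GroundTerm → Prop := TreeOver ∅

theorem genL_reach {t : verifier.GroundTerm} (ht : Plain t) :
    ReflTransGen (system ms h).Step genL t := by
  induction ht with
  | leaf => exact .single step_genL_leaf
  | mem ht => exact ht.elim
  | node _ _ hs ht => exact .head step_genL_node (reach_node hs ht)

theorem genR_reach {t : verifier.GroundTerm} (ht : Plain t) :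
    ReflTransGen (system ms h).Step genR t := by
  induction ht with
  | leaf => exact .single step_genR_leaf
  | mem ht => exact ht.elim
  | node _ _ hs ht => exact .head step_genR_node (reach_node hs ht)

theorem start_reach_check {t : verifier.GroundTerm} (ht : Plain t) :
    ReflTransGen (system ms h).Step (start genL genR) (check leaf t t) :=
  (reach_start (genL_reach ht) (genR_reach ht)).tail (step_start_check t)

/-- One step of the machine whose transitions are the instances of the rules in `ms`. -/
def MachineStep (ms : List verifier.Rule) (t u : verifier.GroundTerm) : Prop :=
  Plain u ∧ ∃ ρ ∈ ms, ∃ σ : ℕ → verifier.GroundTerm, ρ.1.subst σ = t ∧ ρ.2.subst σ = u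

/-- The machine started at `leaf` reaches an instance of `h`. -/
def Accepts (ms : List verifier.Rule) (h : verifier.Term ℕ) : Prop :=
  ∃ σ : ℕ → verifier.GroundTerm, ReflTransGen (MachineStep ms) leaf (h.subst σ)

theorem start_reach_flood (H : Accepts ms h) :
    ReflTransGen (system ms h).Step (start genL genR : verifier.GroundTerm) flood := by
  obtain ⟨σ, hσ⟩ := H
  -- The history `w` is built backwards from the end of the run: each step puts its successor
  -- configuration in front, and the empty history is `leaf`.
  have key : ∀ t u : verifier.GroundTerm, ReflTransGen (MachineStep ms) t u →
      ∃ w, Plain w ∧ ReflTransGen (system ms h).Step (check t w w) (check u leaf leaf) := by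
    intro t u htu
    induction htu using ReflTransGen.head_induction_on with
    | refl => exact ⟨leaf, .leaf, .refl⟩
    | head hs _ ih =>
      obtain ⟨hp, ρ, hρ, τ, rfl, rfl⟩ := hs
      obtain ⟨w, hw, hr⟩ := ih
      exact ⟨node (ρ.2.subst τ) w, .node hp hw, .head (step_check_check hρ τ _ _ _) hr⟩
  obtain ⟨w, hw, hr⟩ := key _ _ hσ
  exact ((start_reach_check hw).trans hr).tail (step_check_flood σ _ _)

/-- A `node` passes on a `flood` from either argument, while `start` and `check` restart whatever
their arguments are. -/
theorem treeOver_or_reach_flood (H : Accepts ms h) (t : verifier.GroundTerm) :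
    TreeOver {genL, genR} t ∨ ReflTransGen (system ms h).Step t flood := by
  induction t using term_induction with
  | var x => exact x.elim
  | leaf => exact .inl .leaf
  | genL => exact .inl (.mem (.inl rfl))
  | genR => exact .inl (.mem (.inr rfl))
  | flood => exact .inr .refl
  | node s t hs ht =>
    rcases hs with hs | hs
    · rcases ht with ht | ht
      · exact .inl (.node hs ht)
      · exact .inr ((reach_node .refl ht).tail (step_node_flood s).2)
    · exact .inr ((reach_node hs .refl).tail (step_node_flood t).1)
  | start s t => exact .inr (.head (step_start_restart s t) (start_reach_flood H))
  | check s t u => exact .inr (.head (step_check_restart s t u) (start_reach_flood H))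

/-! ### Trees over `leaf`, `node` and generators -/

variable {S : Set verifier.GroundTerm}

theorem TreeOver.ne_flood (hS : S ⊆ {genL, genR}) {t : verifier.GroundTerm}
    (ht : TreeOver S t) : t ≠ flood := by
  cases ht with
  | leaf => exact ne_of_head (by simp)
  | mem ht =>
    rcases hS ht with rfl | rfl
    · exact ne_of_head (by simp)
    · exact ne_of_head (by simp)
  | node _ _ => exact ne_of_head (by simp)

theorem TreeOver.of_node (hS : S ⊆ {genL, genR}) {s t : verifier.GroundTerm}
    (ht : TreeOver S (verifier.node s t)) : TreeOver S s ∧ TreeOver S t := by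
  generalize hu : verifier.node s t = u at ht
  cases ht with
  | leaf => exact absurd hu (node_ne_leaf s t)
  | mem ht =>
    rcases hS ht with rfl | rfl
    · exact absurd (congrArg head hu) (by simp)
    · exact absurd (congrArg head hu) (by simp)
  | node hs ht =>
    obtain ⟨rfl, rfl⟩ := node_inj.1 hu
    exact ⟨hs, ht⟩

/-- Without `flood`, `start` and `check` the only redexes are the generators. -/
theorem TreeOver.of_step (hS : S ⊆ {genL, genR}) {t u : verifier.GroundTerm}
    (ht : TreeOver S t) (htu : (system ms h).Step t u) : TreeOver S u := by
  induction ht generalizing u with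
  | leaf => exact absurd (step_leaf htu) not_rootStep_leaf
  | mem ht =>
    rcases hS ht with rfl | rfl
    · rcases rootStep_genL (step_genL htu) with rfl | rfl
      · exact .leaf
      · exact .node (.mem ht) (.mem ht)
    · rcases rootStep_genR (step_genR htu) with rfl | rfl
      · exact .leaf
      · exact .node (.mem ht) (.mem ht)
  | node hs ht ihs iht =>
    rcases step_node htu with hr | ⟨s', hs', rfl⟩ | ⟨t', ht', rfl⟩
    · rcases rootStep_node hr with e | e
      · exact absurd e (hs.ne_flood hS)
      · exact absurd e (ht.ne_flood hS)
    · exact .node (ihs hs') ht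
    · exact .node hs (iht ht')

/-- Hence two equal plain copies of a history cannot drift apart below `check`. -/
theorem Plain.not_step {t u : verifier.GroundTerm} (ht : Plain t) :
    ¬ (system ms h).Step t u := by
  induction ht generalizing u with
  | leaf => exact fun htu => not_rootStep_leaf (step_leaf htu)
  | mem ht => exact ht.elim
  | node hs ht ihs iht =>
    intro htu
    rcases step_node htu with hr | ⟨s', hs', rfl⟩ | ⟨t', ht', rfl⟩
    · rcases rootStep_node hr with e | e
      · exact hs.ne_flood (Set.empty_subset _) e
      · exact ht.ne_flood (Set.empty_subset _) e
    · exact ihs hs'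
    · exact iht ht'

/-- This is why there are two generators: one generator would let `start` pass the equality test
with copies that can still change. -/
theorem plain_of_treeOver {t : verifier.GroundTerm} (hl : TreeOver {genL} t)
    (hr : TreeOver {genR} t) : Plain t := by
  induction hl with
  | leaf => exact .leaf
  | mem ht =>
    rcases ht with rfl
    generalize hu : (genL : verifier.GroundTerm) = u at hr
    cases hr with
    | leaf => exact absurd (congrArg head hu) (by simp)
    | mem ht => rcases ht with rfl; exact absurd (congrArg head hu) (by simp)
    | node _ _ => exact absurd (congrArg head hu) (by simp)
  | node _ _ ihs iht =>
    obtain ⟨hs, ht⟩ := hr.of_node (Set.singleton_subset_iff.2 (.inr rfl))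
    exact .node (ihs hs) (iht ht)

/-! ### Acceptance implies preservation -/

section Recognizability

/-- Supplies finitely many states, closed under subtrees, for `descendantAutomaton`. -/
theorem exists_finite_subtrees {t : verifier.GroundTerm} (ht : TreeOver {genL, genR} t) :
    ∃ U : Set verifier.GroundTerm, U.Finite ∧ t ∈ U ∧ (∀ u ∈ U, TreeOver {genL, genR} u) ∧
      ∀ r s, node r s ∈ U → r ∈ U ∧ s ∈ U := by
  induction ht with
  | leaf =>
    exact ⟨{leaf}, Set.finite_singleton _, rfl, by rintro _ rfl; exact .leaf,
      fun r s e => absurd e (node_ne_leaf r s)⟩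
  | @mem t ht =>
    refine ⟨{t}, Set.finite_singleton _, rfl, by rintro _ rfl; exact .mem ht, fun r s e => ?_⟩
    rcases ht with rfl | rfl <;> exact absurd (congrArg head e) (by simp)
  | @node s t hs ht ihs iht =>
    obtain ⟨U, hUf, hU, hUt, hUc⟩ := ihs
    obtain ⟨W, hWf, hW, hWt, hWc⟩ := iht
    refine ⟨insert (node s t) (U ∪ W), (hUf.union hWf).insert _, .inl rfl, ?_, fun r r' e => ?_⟩
    · rintro u (rfl | hu | hu)
      · exact .node hs ht
      · exact hUt u hu
      · exact hWt u hu
    · rcases e with e | e | e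
      · obtain ⟨rfl, rfl⟩ := node_inj.1 e
        exact ⟨.inr (.inl hU), .inr (.inr hW)⟩
      · exact ⟨.inr (.inl (hUc _ _ e).1), .inr (.inl (hUc _ _ e).2)⟩
      · exact ⟨.inr (.inr (hWc _ _ e).1), .inr (.inr (hWc _ _ e).2)⟩

/-- The automaton whose state `u` accepts the descendants of the tree `u`. -/
def descendantAutomaton (R : verifier.TRS) (U L : Set verifier.GroundTerm) : verifier.BTA U where
  trans f q a := a.1 = .app f (fun i => (q i).1) ∨ RootStep R a.1 (.app f fun i => (q i).1)
  eps _ _ := False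
  final := {u | u.1 ∈ L}

variable {U L : Set verifier.GroundTerm}

theorem reach_of_reaches {R : verifier.TRS} {t : verifier.GroundTerm} {u : U}
    (ht : (descendantAutomaton R U L).Reaches t u) : ReflTransGen R.Step u.1 t := by
  induction ht with
  | trans f ts q a _ htr ih =>
    rcases htr with e | hr
    · rw [e]; exact TRS.reach_app ih
    · exact .head hr.step (TRS.reach_app ih)
  | eps _ _ _ _ he => exact he.elim

theorem reaches_app {R : verifier.TRS} {f : Fin verifier.size}
    {ts : Fin (verifier.rank f) → verifier.GroundTerm} {u : U}
    (ht : (descendantAutomaton R U L).Reaches (.app f ts) u) :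
    ∃ q, (∀ i, (descendantAutomaton R U L).Reaches (ts i) (q i)) ∧
      (descendantAutomaton R U L).trans f q u := by
  cases ht with
  | trans _ _ q _ hq htr => exact ⟨q, hq, htr⟩
  | eps _ _ _ _ he => exact he.elim

theorem reaches_node {R : verifier.TRS} {s t : verifier.GroundTerm} {u : U}
    (ht : (descendantAutomaton R U L).Reaches (node s t) u) :
    ∃ q r, (descendantAutomaton R U L).Reaches s q ∧ (descendantAutomaton R U L).Reaches t r ∧
      (u.1 = node q.1 r.1 ∨ RootStep R u.1 (node q.1 r.1)) := by
  obtain ⟨q, hq, htr⟩ := reaches_app ht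
  have e : (Term.app (4 : Fin 7) fun i => (q i).1 : verifier.GroundTerm) =
      node (q (0 : Fin 2)).1 (q (1 : Fin 2)).1 :=
    congrArg (Term.app _) (funext fun i : Fin 2 => by fin_cases i <;> rfl)
  exact ⟨q (0 : Fin 2), q (1 : Fin 2), hq (0 : Fin 2), hq (1 : Fin 2), e ▸ htr⟩

theorem reaches_of_node {R : verifier.TRS} {s t : verifier.GroundTerm} {u q r : U}
    (hs : (descendantAutomaton R U L).Reaches s q) (ht : (descendantAutomaton R U L).Reaches t r)
    (hu : u.1 = node q.1 r.1 ∨ RootStep R u.1 (node q.1 r.1)) :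
    (descendantAutomaton R U L).Reaches (node s t) u := by
  have e : (Term.app (4 : Fin 7) fun i => ((![q, r] : Fin 2 → U) i).1 : verifier.GroundTerm) =
      node q.1 r.1 :=
    congrArg (Term.app _) (funext fun i : Fin 2 => by fin_cases i <;> rfl)
  have hqr : ∀ i : Fin 2, (descendantAutomaton R U L).Reaches
      ((![s, t] : Fin 2 → _) i) ((![q, r] : Fin 2 → U) i) := Fin.forall_fin_two.2 ⟨hs, ht⟩
  rw [← e] at hu
  exact BTA.Reaches.trans (F := verifier) (4 : Fin 7) (![s, t] : Fin 2 → _)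
    (![q, r] : Fin 2 → U) u hqr hu

theorem reaches_const {R : verifier.TRS} {f : Fin verifier.size}
    {ts : Fin (verifier.rank f) → verifier.GroundTerm} (hf : IsEmpty (Fin (verifier.rank f)))
    {u : U} :
    (descendantAutomaton R U L).Reaches (.app f ts) u ↔
      u.1 = .app f ts ∨ RootStep R u.1 (.app f ts) := by
  have e : ∀ q : Fin (verifier.rank f) → U, (fun i => (q i).1) = ts :=
    fun q => funext fun i => (hf.false i).elim
  constructor
  · intro ht
    obtain ⟨q, -, htr⟩ := reaches_app ht
    exact e q ▸ htr
  · intro hu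
    refine .trans f ts (fun i => (hf.false i).elim) u (fun i => (hf.false i).elim) ?_
    simpa only [descendantAutomaton, e] using hu

theorem reaches_leaf {R : verifier.TRS} {u : U} :
    (descendantAutomaton R U L).Reaches leaf u ↔ u.1 = leaf ∨ RootStep R u.1 leaf :=
  reaches_const (inferInstanceAs (IsEmpty (Fin 0)))
theorem reaches_genL {R : verifier.TRS} {u : U} :
    (descendantAutomaton R U L).Reaches genL u ↔ u.1 = genL ∨ RootStep R u.1 genL :=
  reaches_const (inferInstanceAs (IsEmpty (Fin 0)))
theorem reaches_genR {R : verifier.TRS} {u : U} :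
    (descendantAutomaton R U L).Reaches genR u ↔ u.1 = genR ∨ RootStep R u.1 genR :=
  reaches_const (inferInstanceAs (IsEmpty (Fin 0)))

/-- A root step never produces a generator, so a state that reads a generator is that generator. -/
theorem TreeOver.head_of_rootStep {t u : verifier.GroundTerm} (ht : TreeOver {genL, genR} t)
    (htu : RootStep (system ms h) t u) : u = verifier.leaf ∨ head u = 4 := by
  cases ht with
  | leaf => exact absurd htu not_rootStep_leaf
  | mem ht =>
    rcases ht with rfl | rfl
    · exact (rootStep_genL htu).imp_right fun e => by rw [e]; rfl
    · exact (rootStep_genR htu).imp_right fun e => by rw [e]; rfl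
  | node hs ht =>
    rcases rootStep_node htu with e | e
    · exact absurd e (hs.ne_flood subset_rfl)
    · exact absurd e (ht.ne_flood subset_rfl)

theorem reaches_self (hU : ∀ u ∈ U, TreeOver {genL, genR} u)
    (hUc : ∀ r s, node r s ∈ U → r ∈ U ∧ s ∈ U) {t : verifier.GroundTerm} (ht : t ∈ U) :
    (descendantAutomaton (system ms h) U L).Reaches t ⟨t, ht⟩ := by
  induction hU t ht with
  | leaf => exact reaches_leaf.2 (.inl rfl)
  | mem hm =>
    rcases hm with rfl | rfl
    · exact reaches_genL.2 (.inl rfl)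
    · exact reaches_genR.2 (.inl rfl)
  | node _ _ ihs iht =>
    exact reaches_of_node (ihs (hUc _ _ ht).1) (iht (hUc _ _ ht).2) (.inl rfl)

/-- Only a generator can be rewritten, and it is read in its own state. That state also reads the
result, through a root-step transition whose arguments are again in the generator's state. One root
step per transition suffices because a result `leaf` or `node` has no further root step. -/
theorem reaches_of_step (hU : ∀ u ∈ U, TreeOver {genL, genR} u) (hl : genL ∈ U) (hr : genR ∈ U)
    {t t' : verifier.GroundTerm} (ht : TreeOver {genL, genR} t)
    (htt' : (system ms h).Step t t') {u : U}
    (hu : (descendantAutomaton (system ms h) U L).Reaches t u) :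
    (descendantAutomaton (system ms h) U L).Reaches t' u := by
  induction ht generalizing t' u with
  | leaf => exact absurd (step_leaf htt') not_rootStep_leaf
  | mem ht =>
    rcases ht with rfl | rfl
    · have hs := step_genL htt'
      rcases reaches_genL.1 hu with e | e
      · rcases rootStep_genL hs with rfl | rfl
        · exact reaches_leaf.2 (.inr (by rwa [e]))
        · have : (descendantAutomaton (system ms h) U L).Reaches genL ⟨genL, hl⟩ :=
            reaches_genL.2 (.inl rfl)
          exact reaches_of_node this this (.inr (by rwa [e]))
      · rcases (hU u u.2).head_of_rootStep e with e | e
        · exact absurd (congrArg head e) (by simp)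
        · simp at e
    · have hs := step_genR htt'
      rcases reaches_genR.1 hu with e | e
      · rcases rootStep_genR hs with rfl | rfl
        · exact reaches_leaf.2 (.inr (by rwa [e]))
        · have : (descendantAutomaton (system ms h) U L).Reaches genR ⟨genR, hr⟩ :=
            reaches_genR.2 (.inl rfl)
          exact reaches_of_node this this (.inr (by rwa [e]))
      · rcases (hU u u.2).head_of_rootStep e with e | e
        · exact absurd (congrArg head e) (by simp)
        · simp at e
  | node hs ht ihs iht =>
    obtain ⟨q, r, hq, hr', htr⟩ := reaches_node hu
    rcases step_node htt' with hroot | ⟨s', hs', rfl⟩ | ⟨t', ht', rfl⟩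
    · rcases rootStep_node hroot with e | e
      · exact absurd e (hs.ne_flood subset_rfl)
      · exact absurd e (ht.ne_flood subset_rfl)
    · exact reaches_of_node (ihs hs' hq) hr' htr
    · exact reaches_of_node hq (iht ht' hr') htr

theorem recognizable_descendants_of_treeOver (hL : L.Finite)
    (ht : ∀ t ∈ L, TreeOver {genL, genR} t) : Recognizable ((system ms h).descendants L) := by
  choose! W hWf hW hWt hWc using fun t (h : t ∈ L) => exists_finite_subtrees (ht t h)
  let U : Set verifier.GroundTerm := (⋃ t ∈ L, W t) ∪ {genL, genR}
  have hUf : U.Finite := (hL.biUnion hWf).union (Set.toFinite _)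
  have hLU : L ⊆ U := fun t h => .inl (Set.mem_biUnion h (hW t h))
  have hUt : ∀ u ∈ U, TreeOver {genL, genR} u := by
    rintro u (hu | hu)
    · obtain ⟨t, h, hu⟩ := Set.mem_iUnion₂.1 hu
      exact hWt t h u hu
    · exact .mem hu
  have hUc : ∀ r s, node r s ∈ U → r ∈ U ∧ s ∈ U := by
    rintro r s (hu | hu | hu)
    · obtain ⟨t, h, hu⟩ := Set.mem_iUnion₂.1 hu
      exact ⟨.inl (Set.mem_biUnion h (hWc t h _ _ hu).1),
        .inl (Set.mem_biUnion h (hWc t h _ _ hu).2)⟩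
    · exact absurd (congrArg head hu) (by simp)
    · exact absurd (congrArg head hu) (by simp)
  refine ⟨U, hUf, descendantAutomaton (system ms h) U L, Set.ext fun t => ⟨?_, ?_⟩⟩
  · rintro ⟨u, hu, htu⟩
    exact ⟨u.1, hu, reach_of_reaches htu⟩
  · rintro ⟨u, hu, hut⟩
    refine ⟨⟨u, hLU hu⟩, hu, ?_⟩
    suffices TreeOver {genL, genR} t ∧
      (descendantAutomaton (system ms h) U L).Reaches t ⟨u, hLU hu⟩ from this.2
    induction hut with
    | refl => exact ⟨ht u hu, reaches_self hUt hUc _⟩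
    | tail _ hs ih =>
      exact ⟨ih.1.of_step subset_rfl hs,
        reaches_of_step hUt (.inr (.inl rfl)) (.inr (.inr rfl)) ih.1 hs ih.2⟩

theorem recognizable_univ : Recognizable (Set.univ : Set verifier.GroundTerm) := by
  refine ⟨Unit, inferInstance, ⟨fun _ _ _ => True, fun _ _ => False, Set.univ⟩,
    Set.eq_univ_of_forall fun t => ⟨(), trivial, ?_⟩⟩
  induction t with
  | var x => exact x.elim
  | app f ts ih => exact .trans f ts (fun _ => ()) () ih trivial

theorem preserves_of_accepts (H : Accepts ms h) :
    (system ms h).PreservesFiniteRecognizability := by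
  intro L hL
  by_cases hf : ∃ t ∈ L, ReflTransGen (system ms h).Step t flood
  · obtain ⟨t, ht, hf⟩ := hf
    have : (system ms h).descendants L = Set.univ :=
      Set.eq_univ_of_forall fun u => ⟨t, ht, hf.trans (flood_reach u)⟩
    rw [this]
    exact recognizable_univ
  · refine recognizable_descendants_of_treeOver hL fun t ht => ?_
    exact (treeOver_or_reach_flood H t).resolve_right fun hr => hf ⟨t, ht, hr⟩

end Recognizability

/-! ### Preservation implies acceptance -/

section Nonrecognizability

/-- The trees reachable from `start genL genR` when the machine does not accept. -/
def Genuine (ms : List verifier.Rule) (t : verifier.GroundTerm) : Prop :=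
  (∃ r s, t = start r s ∧ TreeOver {genL} r ∧ TreeOver {genR} s) ∨
    ∃ r w, t = check r w w ∧ Plain r ∧ Plain w ∧ ReflTransGen (MachineStep ms) leaf r

theorem genuine_start : Genuine ms (start genL genR) :=
  .inl ⟨_, _, rfl, .mem rfl, .mem rfl⟩

theorem Genuine.of_step (H : ¬ Accepts ms h) {t u : verifier.GroundTerm} (ht : Genuine ms t)
    (htu : (system ms h).Step t u) : Genuine ms u := by
  rcases ht with ⟨r, s, rfl, hr, hs⟩ | ⟨r, w, rfl, hr, hw, hm⟩
  · rcases step_start htu with hroot | ⟨r', hr', rfl⟩ | ⟨s', hs', rfl⟩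
    · rcases rootStep_start hroot with ⟨rfl, rfl⟩ | rfl
      · exact .inr ⟨_, _, rfl, .leaf, plain_of_treeOver hr hs, .refl⟩
      · exact genuine_start
    · exact .inl ⟨_, _, rfl, hr.of_step (Set.singleton_subset_iff.2 (.inl rfl)) hr', hs⟩
    · exact .inl ⟨_, _, rfl, hr, hs.of_step (Set.singleton_subset_iff.2 (.inr rfl)) hs'⟩
  · rcases step_check htu with hroot | ⟨_, hs, -⟩ | ⟨_, hs, -⟩ | ⟨_, hs, -⟩
    · rcases rootStep_check hroot with ⟨ρ, hρ, σ, x, y, z, rfl, rfl, e, rfl⟩ | rfl | ⟨σ, rfl⟩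
      -- As the copies agree, the head of the second is the successor tested against the first.
      · obtain ⟨rfl, rfl⟩ := node_inj.1 e
        obtain ⟨hx, hy⟩ := hw.of_node (Set.empty_subset _)
        exact .inr ⟨_, _, rfl, hx, hy, hm.tail ⟨hx, ρ, hρ, σ, rfl, rfl⟩⟩
      · exact genuine_start
      · exact absurd ⟨σ, hm⟩ H
    · exact absurd hs hr.not_step
    · exact absurd hs hw.not_step
    · exact absurd hs hw.not_step

/-- Natural numbers as trees. -/
def num {V : Type} : ℕ → verifier.Term V
  | 0 => leaf
  | n + 1 => node leaf (num n)

theorem plain_num (n : ℕ) : Plain (num n) := by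
  induction n with
  | zero => exact .leaf
  | succ n ih => exact .node .leaf ih

theorem num_injective {V : Type} : Function.Injective (num : ℕ → verifier.Term V) := by
  intro m
  induction m with
  | zero =>
    rintro (_ | n) e
    · rfl
    · exact absurd e (leaf_ne_node _ _)
  | succ m ih =>
    rintro (_ | n) e
    · exact absurd e (node_ne_leaf _ _)
    · exact congrArg _ (ih (node_inj.1 e).2)

theorem accepts_of_preserves (hP : (system ms h).PreservesFiniteRecognizability) :
    Accepts ms h := by
  by_contra H
  obtain ⟨A, hA, B, hB⟩ := hP {start genL genR} (Set.finite_singleton _)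
  -- There are finitely many sets of states, so two numerals reach the same states and are
  -- interchangeable below `check`.
  obtain ⟨m, n, hmn, he⟩ := Finite.exists_ne_map_eq_of_infinite
    fun n : ℕ => {q | B.Reaches (num n) q}
  have hmem : check leaf (num m) (num m) ∈ B.language := by
    rw [hB]
    exact ⟨_, rfl, start_reach_check (plain_num m)⟩
  obtain ⟨a, ha, hr⟩ := hmem
  have hmem : check leaf (num m) (num n) ∈ B.language := by
    refine ⟨a, ha, hr.congr_args (Fin.forall_fin_succ.2 ⟨fun q hq => hq,
      Fin.forall_fin_two.2 ⟨fun q hq => hq, fun q hq => ?_⟩⟩)⟩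
    exact (Set.ext_iff.1 he q).1 hq
  rw [hB] at hmem
  obtain ⟨_, rfl, hreach⟩ := hmem
  have hg : Genuine ms (check leaf (num m) (num n)) := by
    generalize check leaf (num m) (num n) = t at hreach
    induction hreach with
    | refl => exact genuine_start
    | tail _ hs ih => exact ih.of_step H hs
  rcases hg with ⟨_, _, e, -⟩ | ⟨_, _, e, -⟩
  · exact absurd (congrArg head e) (by simp)
  · obtain ⟨-, rfl, e⟩ := check_inj.1 e
    exact hmn (num_injective e.symm)

end Nonrecognizability

theorem preserves_iff_accepts :
    (system ms h).PreservesFiniteRecognizability ↔ Accepts ms h :=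
  ⟨accepts_of_preserves, preserves_of_accepts⟩

/-! ### An evaluator with elementary steps -/

open Turing.ToPartrec (Code Cont Cfg stepNormal stepRet)

/-- Configurations of an evaluator for `Turing.ToPartrec.Code` that works in elementary steps. -/
inductive Config
  | normal (c : Code) (k : Cont) (v : List ℕ)
  | ret (k : Cont) (v : List ℕ)

/-- The elementary steps of the evaluator. -/
def Config.next : Config → Option Config
  | .normal .zero' k v => some (.ret k (0 :: v))
  | .normal .succ k [] => some (.ret k [1])
  | .normal .succ k (n :: _) => some (.ret k [n + 1])
  | .normal .tail k [] => some (.ret k [])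
  | .normal .tail k (_ :: v) => some (.ret k v)
  | .normal (.cons f g) k v => some (.normal f (.cons₁ g v k) v)
  | .normal (.comp f g) k v => some (.normal g (.comp f k) v)
  | .normal (.case f _) k [] => some (.normal f k [])
  | .normal (.case f _) k (0 :: v) => some (.normal f k v)
  | .normal (.case _ g) k ((n + 1) :: v) => some (.normal g k (n :: v))
  | .normal (.fix f) k v => some (.normal f (.fix f k) v)
  | .ret .halt _ => none
  | .ret (.cons₁ g w k) v => some (.normal g (.cons₂ v k) w)
  | .ret (.cons₂ [] k) v => some (.ret k (0 :: v))
  | .ret (.cons₂ (n :: _) k) v => some (.ret k (n :: v))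
  | .ret (.comp f k) v => some (.normal f k v)
  | .ret (.fix _ k) [] => some (.ret k [])
  | .ret (.fix _ k) (0 :: v) => some (.ret k v)
  | .ret (.fix f k) ((_ + 1) :: v) => some (.normal f (.fix f k) v)

abbrev Config.Step (x y : Config) : Prop := x.next = some y

def Config.toCfg : Config → Cfg
  | .normal c k v => stepNormal c k v
  | .ret k v => stepRet k v

/-- `stepNormal` and `stepRet` unfold recursively, so most elementary steps are invisible in `Cfg`;
a true step occurs exactly when `zero'`, `succ` or `tail` returns. -/
theorem Config.reaches_toCfg {x y : Config} (hxy : x.Step y) :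
    StateTransition.Reaches Turing.ToPartrec.step x.toCfg y.toCfg := by
  revert hxy
  fun_cases Config.next x <;> rintro ⟨⟩
  all_goals first
    | exact ReflTransGen.refl
    | exact ReflTransGen.single rfl

theorem Config.normal_reach (c : Code) (k : Cont) (v : List ℕ) :
    ∃ k' w, stepNormal c k v = .ret k' w ∧
      ReflTransGen Config.Step (.normal c k v) (.ret k' w) := by
  induction c generalizing k v with
  | zero' => exact ⟨k, 0 :: v, rfl, .single rfl⟩
  | succ => cases v <;> exact ⟨_, _, rfl, .single rfl⟩
  | tail => cases v <;> exact ⟨_, _, rfl, .single rfl⟩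
  | cons f g ihf _ =>
    obtain ⟨k', w, e, hr⟩ := ihf (.cons₁ g v k) v
    exact ⟨k', w, e, .head rfl hr⟩
  | comp f g _ ihg =>
    obtain ⟨k', w, e, hr⟩ := ihg (.comp f k) v
    exact ⟨k', w, e, .head rfl hr⟩
  | case f g ihf ihg =>
    rcases v with _ | ⟨_ | n, v⟩
    · obtain ⟨k', w, e, hr⟩ := ihf k []
      exact ⟨k', w, e, .head rfl hr⟩
    · obtain ⟨k', w, e, hr⟩ := ihf k v
      exact ⟨k', w, e, .head rfl hr⟩
    · obtain ⟨k', w, e, hr⟩ := ihg k (n :: v)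
      exact ⟨k', w, e, .head rfl hr⟩
  | fix f ih =>
    obtain ⟨k', w, e, hr⟩ := ih (.fix f k) v
    exact ⟨k', w, e, .head rfl hr⟩

/-- Frames `cons₂` and finished `fix` frames are popped within one `stepRet`; this ends at `halt` or
at a frame that starts a new code, where `normal_reach` takes over. -/
theorem Config.ret_reach (k : Cont) (v : List ℕ) :
    (∃ w, ReflTransGen Config.Step (.ret k v) (.ret .halt w)) ∨
      ∃ k' w, stepRet k v = .ret k' w ∧
        ReflTransGen Config.Step (.ret k v) (.ret k' w) := by
  induction k generalizing v with
  | halt => exact .inl ⟨v, .refl⟩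
  | cons₁ g w k =>
    obtain ⟨k', w, e, hr⟩ := normal_reach g (.cons₂ v k) w
    exact .inr ⟨k', w, e, .head rfl hr⟩
  | cons₂ u k ih =>
    have hs : Config.Step (.ret (.cons₂ u k) v) (.ret k (u.headI :: v)) := by cases u <;> rfl
    exact (ih (u.headI :: v)).imp (fun ⟨w, hr⟩ => ⟨w, .head hs hr⟩)
      fun ⟨k', w, e, hr⟩ => ⟨k', w, e, .head hs hr⟩
  | comp f k =>
    obtain ⟨k', w, e, hr⟩ := normal_reach f k v
    exact .inr ⟨k', w, e, .head rfl hr⟩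
  | fix f k ih =>
    rcases v with _ | ⟨_ | n, v⟩
    · exact (ih []).imp (fun ⟨w, hr⟩ => ⟨w, .head rfl hr⟩)
        fun ⟨k', w, e, hr⟩ => ⟨k', w, e, .head rfl hr⟩
    · exact (ih v).imp (fun ⟨w, hr⟩ => ⟨w, .head rfl hr⟩)
        fun ⟨k', w, e, hr⟩ => ⟨k', w, e, .head rfl hr⟩
    · obtain ⟨k', w, e, hr⟩ := normal_reach f (.fix f k) v
      exact .inr ⟨k', w, e, .head rfl hr⟩

theorem Config.reach_halt_of_reaches {a : Cfg} {u : List ℕ}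
    (h : StateTransition.Reaches Turing.ToPartrec.step a (.halt u)) {k : Cont} {v : List ℕ}
    (ha : a = .ret k v) : ∃ w, ReflTransGen Config.Step (.ret k v) (.ret .halt w) := by
  induction h using ReflTransGen.head_induction_on generalizing k v with
  | refl => cases ha
  | head hab _ ih =>
    subst ha
    cases hab
    rcases ret_reach k v with hr | ⟨k', w, e, hr⟩
    · exact hr
    · obtain ⟨w', hr'⟩ := ih e
      exact ⟨w', hr.trans hr'⟩

theorem Config.eval_dom_iff (c : Code) (v : List ℕ) : (c.eval v).Dom ↔
    ∃ w, ReflTransGen Config.Step (.normal c .halt v) (.ret .halt w) := by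
  have hdom : (c.eval v).Dom ↔
      (StateTransition.eval Turing.ToPartrec.step (stepNormal c .halt v)).Dom := by
    rw [Turing.ToPartrec.stepNormal_eval]
    rfl
  rw [hdom]
  constructor
  · intro hd
    obtain ⟨u, -, hu⟩ : ∃ u ∈ c.eval v, Cfg.halt u ∈
        StateTransition.eval Turing.ToPartrec.step (stepNormal c .halt v) := by
      rw [Turing.ToPartrec.stepNormal_eval]
      exact ⟨_, Part.get_mem (hdom.2 hd), Part.mem_map _ (Part.get_mem _)⟩
    obtain ⟨k, w, e, hr⟩ := normal_reach c .halt v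
    obtain ⟨w', hr'⟩ := reach_halt_of_reaches (StateTransition.mem_eval.1 hu).1 e
    exact ⟨w', hr.trans hr'⟩
  · rintro ⟨w, hr⟩
    have hr' : StateTransition.Reaches Turing.ToPartrec.step (stepNormal c .halt v) (.halt w) := by
      have : ∀ x y : Config, ReflTransGen Config.Step x y →
          StateTransition.Reaches Turing.ToPartrec.step x.toCfg y.toCfg := by
        intro x y hxy
        induction hxy with
        | refl => exact ReflTransGen.refl
        | tail _ hs ih => exact ReflTransGen.trans ih (reaches_toCfg hs)
      exact this _ _ hr
    exact Part.dom_iff_mem.2 ⟨_, StateTransition.mem_eval.2 ⟨hr', rfl⟩⟩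

/-! ### Configurations as binary trees -/

section Encoding

variable {V W : Type}

def tagged (k : ℕ) (t : verifier.Term V) : verifier.Term V := node (num k) t

@[simp] theorem num_inj {m n : ℕ} : (num m : verifier.Term V) = num n ↔ m = n :=
  num_injective.eq_iff

@[simp] theorem tagged_inj {j k : ℕ} {s t : verifier.Term V} :
    tagged j s = tagged k t ↔ j = k ∧ s = t := by
  simp [tagged]

@[simp] theorem tagged_ne_leaf (k : ℕ) (t : verifier.Term V) : tagged k t ≠ leaf :=
  node_ne_leaf _ _

@[simp] theorem subst_num (σ : V → verifier.Term W) (n : ℕ) :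
    (num n : verifier.Term V).subst σ = num n := by
  induction n with
  | zero => exact subst_leaf σ
  | succ n ih => simp [num, ih]

@[simp] theorem subst_tagged (σ : V → verifier.Term W) (k : ℕ) (t : verifier.Term V) :
    (tagged k t).subst σ = tagged k (t.subst σ) := by
  simp [tagged]

def encodeList : List ℕ → verifier.Term V
  | [] => leaf
  | n :: v => node (num n) (encodeList v)

def encodeCode : Code → verifier.Term V
  | .zero' => tagged 0 leaf
  | .succ => tagged 1 leaf
  | .tail => tagged 2 leaf
  | .cons f g => tagged 3 (node (encodeCode f) (encodeCode g))
  | .comp f g => tagged 4 (node (encodeCode f) (encodeCode g))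
  | .case f g => tagged 5 (node (encodeCode f) (encodeCode g))
  | .fix f => tagged 6 (encodeCode f)

def encodeCont : Cont → verifier.Term V
  | .halt => tagged 0 leaf
  | .cons₁ g w k => tagged 1 (node (encodeCode g) (node (encodeList w) (encodeCont k)))
  | .cons₂ w k => tagged 2 (node (encodeList w) (encodeCont k))
  | .comp f k => tagged 3 (node (encodeCode f) (encodeCont k))
  | .fix f k => tagged 4 (node (encodeCode f) (encodeCont k))

def normalTerm (c k v : verifier.Term V) : verifier.Term V := tagged 0 (node c (node k v))

def retTerm (k v : verifier.Term V) : verifier.Term V := tagged 1 (node k v)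

def encodeConfig : Config → verifier.Term V
  | .normal c k v => normalTerm (encodeCode c) (encodeCont k) (encodeList v)
  | .ret k v => retTerm (encodeCont k) (encodeList v)

@[simp] theorem subst_encodeList (σ : V → verifier.Term W) (v : List ℕ) :
    (encodeList v).subst σ = encodeList v := by
  induction v with
  | nil => exact subst_leaf σ
  | cons n v ih => simp [encodeList, ih]

@[simp] theorem subst_encodeCode (σ : V → verifier.Term W) (c : Code) :
    (encodeCode c).subst σ = encodeCode c := by
  induction c <;> simp [encodeCode, *]

@[simp] theorem subst_encodeCont (σ : V → verifier.Term W) (k : Cont) :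
    (encodeCont k).subst σ = encodeCont k := by
  induction k <;> simp [encodeCont, *]

@[simp] theorem subst_encodeConfig (σ : V → verifier.Term W) (x : Config) :
    (encodeConfig x).subst σ = encodeConfig x := by
  cases x <;> simp [encodeConfig, normalTerm, retTerm]

theorem encodeConfig_ne_leaf (x : Config) : (encodeConfig x : verifier.Term V) ≠ leaf := by
  cases x <;> exact tagged_ne_leaf _ _

theorem plain_tagged {k : ℕ} {t : verifier.GroundTerm} (ht : Plain t) : Plain (tagged k t) :=
  .node (plain_num k) ht

theorem plain_encodeList (v : List ℕ) : Plain (encodeList v) := by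
  induction v with
  | nil => exact .leaf
  | cons n v ih => exact .node (plain_num n) ih

theorem plain_encodeCode (c : Code) : Plain (encodeCode c) := by
  induction c with
  | zero' | succ | tail => exact plain_tagged .leaf
  | cons f g hf hg | comp f g hf hg | case f g hf hg => exact plain_tagged (.node hf hg)
  | fix f hf => exact plain_tagged hf

theorem plain_encodeCont (k : Cont) : Plain (encodeCont k) := by
  induction k with
  | halt => exact plain_tagged .leaf
  | cons₁ g w k ih =>
    exact plain_tagged (.node (plain_encodeCode g) (.node (plain_encodeList w) ih))
  | cons₂ w k ih => exact plain_tagged (.node (plain_encodeList w) ih)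
  | comp f k ih | fix f k ih => exact plain_tagged (.node (plain_encodeCode f) ih)

theorem plain_encodeConfig (x : Config) : Plain (encodeConfig x) := by
  cases x with
  | normal c k v =>
    exact plain_tagged (.node (plain_encodeCode c)
      (.node (plain_encodeCont k) (plain_encodeList v)))
  | ret k v => exact plain_tagged (.node (plain_encodeCont k) (plain_encodeList v))

end Encoding

/-! ### Elementary steps as rule instances -/

section Rules

/-- The elementary steps of the evaluator as rules. -/
def evaluatorRules : List verifier.Rule :=
  [(normalTerm (tagged 0 leaf) (.var 0) (.var 1), retTerm (.var 0) (node leaf (.var 1))),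
   (normalTerm (tagged 1 leaf) (.var 0) leaf, retTerm (.var 0) (node (node leaf leaf) leaf)),
   (normalTerm (tagged 1 leaf) (.var 0) (node (.var 1) (.var 2)),
     retTerm (.var 0) (node (node leaf (.var 1)) leaf)),
   (normalTerm (tagged 2 leaf) (.var 0) leaf, retTerm (.var 0) leaf),
   (normalTerm (tagged 2 leaf) (.var 0) (node (.var 1) (.var 2)), retTerm (.var 0) (.var 2)),
   (normalTerm (tagged 3 (node (.var 0) (.var 1))) (.var 2) (.var 3),
     normalTerm (.var 0) (tagged 1 (node (.var 1) (node (.var 3) (.var 2)))) (.var 3)),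
   (normalTerm (tagged 4 (node (.var 0) (.var 1))) (.var 2) (.var 3),
     normalTerm (.var 1) (tagged 3 (node (.var 0) (.var 2))) (.var 3)),
   (normalTerm (tagged 5 (node (.var 0) (.var 1))) (.var 2) leaf,
     normalTerm (.var 0) (.var 2) leaf),
   (normalTerm (tagged 5 (node (.var 0) (.var 1))) (.var 2) (node leaf (.var 3)),
     normalTerm (.var 0) (.var 2) (.var 3)),
   (normalTerm (tagged 5 (node (.var 0) (.var 1))) (.var 2) (node (node leaf (.var 4)) (.var 3)),
     normalTerm (.var 1) (.var 2) (node (.var 4) (.var 3))),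
   (normalTerm (tagged 6 (.var 0)) (.var 1) (.var 2),
     normalTerm (.var 0) (tagged 4 (node (.var 0) (.var 1))) (.var 2)),
   (retTerm (tagged 1 (node (.var 0) (node (.var 1) (.var 2)))) (.var 3),
     normalTerm (.var 0) (tagged 2 (node (.var 3) (.var 2))) (.var 1)),
   (retTerm (tagged 2 (node leaf (.var 0))) (.var 1), retTerm (.var 0) (node leaf (.var 1))),
   (retTerm (tagged 2 (node (node (.var 2) (.var 3)) (.var 0))) (.var 1),
     retTerm (.var 0) (node (.var 2) (.var 1))),
   (retTerm (tagged 3 (node (.var 0) (.var 1))) (.var 2),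
     normalTerm (.var 0) (.var 1) (.var 2)),
   (retTerm (tagged 4 (node (.var 0) (.var 1))) leaf, retTerm (.var 1) leaf),
   (retTerm (tagged 4 (node (.var 0) (.var 1))) (node leaf (.var 2)),
     retTerm (.var 1) (.var 2)),
   (retTerm (tagged 4 (node (.var 0) (.var 1))) (node (node leaf (.var 3)) (.var 2)),
     normalTerm (.var 0) (tagged 4 (node (.var 0) (.var 1))) (.var 2))]

attribute [local simp] encodeConfig encodeCode encodeCont encodeList normalTerm retTerm num

theorem exists_evaluatorRule {x y : Config} (hxy : x.Step y) :
    ∃ ρ ∈ evaluatorRules, ∃ σ : ℕ → verifier.GroundTerm,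
      ρ.1.subst σ = encodeConfig x ∧ ρ.2.subst σ = encodeConfig y := by
  -- The rules follow the order of the equations of `Config.next`, the terminal one omitted; `ts`
  -- lists the values of the variables, and the default `leaf` is immaterial.
  have key : ∀ (i : ℕ) (hi : i < evaluatorRules.length) (ts : List verifier.GroundTerm),
      (evaluatorRules[i].1.subst (fun j => ts.getD j leaf) = encodeConfig x ∧
        evaluatorRules[i].2.subst (fun j => ts.getD j leaf) = encodeConfig y) →
      ∃ ρ ∈ evaluatorRules, ∃ σ : ℕ → verifier.GroundTerm,
        ρ.1.subst σ = encodeConfig x ∧ ρ.2.subst σ = encodeConfig y :=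
    fun i hi ts e => ⟨_, List.getElem_mem hi, _, e⟩
  revert hxy key
  fun_cases Config.next x <;> rintro ⟨⟩ key
  · next k v =>
    exact key 0 (by decide) [encodeCont k, encodeList v] (by simp [evaluatorRules])
  · next k =>
    exact key 1 (by decide) [encodeCont k] (by simp [evaluatorRules])
  · next k n v =>
    exact key 2 (by decide) [encodeCont k, num n, encodeList v] (by simp [evaluatorRules])
  · next k =>
    exact key 3 (by decide) [encodeCont k] (by simp [evaluatorRules])
  · next k n v =>
    exact key 4 (by decide) [encodeCont k, num n, encodeList v] (by simp [evaluatorRules])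
  · next f g k v =>
    exact key 5 (by decide) [encodeCode f, encodeCode g, encodeCont k, encodeList v]
      (by simp [evaluatorRules])
  · next f g k v =>
    exact key 6 (by decide) [encodeCode f, encodeCode g, encodeCont k, encodeList v]
      (by simp [evaluatorRules])
  · next f g k =>
    exact key 7 (by decide) [encodeCode f, encodeCode g, encodeCont k] (by simp [evaluatorRules])
  · next f g k v =>
    exact key 8 (by decide) [encodeCode f, encodeCode g, encodeCont k, encodeList v]
      (by simp [evaluatorRules])
  · next f g k n v =>
    exact key 9 (by decide) [encodeCode f, encodeCode g, encodeCont k, encodeList v, num n]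
      (by simp [evaluatorRules])
  · next f k v =>
    exact key 10 (by decide) [encodeCode f, encodeCont k, encodeList v] (by simp [evaluatorRules])
  · next g w k v =>
    exact key 11 (by decide) [encodeCode g, encodeList w, encodeCont k, encodeList v]
      (by simp [evaluatorRules])
  · next k v =>
    exact key 12 (by decide) [encodeCont k, encodeList v] (by simp [evaluatorRules])
  · next n w k v =>
    exact key 13 (by decide) [encodeCont k, encodeList v, num n, encodeList w]
      (by simp [evaluatorRules])
  · next f k v =>
    exact key 14 (by decide) [encodeCode f, encodeCont k, encodeList v] (by simp [evaluatorRules])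
  · next f k =>
    exact key 15 (by decide) [encodeCode f, encodeCont k] (by simp [evaluatorRules])
  · next f k v =>
    exact key 16 (by decide) [encodeCode f, encodeCont k, encodeList v] (by simp [evaluatorRules])
  · next f k n v =>
    exact key 17 (by decide) [encodeCode f, encodeCont k, encodeList v, num n]
      (by simp [evaluatorRules])

theorem config_step_of_rule {ρ : verifier.Rule} (hρ : ρ ∈ evaluatorRules)
    {σ : ℕ → verifier.GroundTerm} {x : Config} (e : ρ.1.subst σ = encodeConfig x) :
    ∃ y, x.Step y ∧ ρ.2.subst σ = encodeConfig y := by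
  simp only [evaluatorRules, List.mem_cons, List.not_mem_nil, or_false] at hρ
  rcases hρ with rfl | rfl | rfl | rfl | rfl | rfl | rfl | rfl | rfl | rfl | rfl | rfl | rfl |
    rfl | rfl | rfl | rfl | rfl
  all_goals
    revert e
    fun_cases Config.next x
  -- Tags and list shapes refute every pairing of a rule with a different equation of `Config.next`;
  -- the matching pairs remain.
  all_goals
    simp only [encodeConfig, encodeCode, encodeCont, encodeList, normalTerm, retTerm, num,
      subst_tagged, subst_node, subst_leaf, subst_var, tagged_inj, node_inj, leaf_ne_node,
      node_ne_leaf, Nat.reduceEqDiff, false_and, and_false, true_and, and_true,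
      false_implies, OfNat.ofNat_ne_zero, zero_ne_one, one_ne_zero, Config.Step, Config.next]
  all_goals
    intro e
    refine ⟨_, rfl, ?_⟩
    simp [e]

end Rules

/-- The evaluator, which moves from `leaf` to the evaluation of `c` at `[n]`. -/
def machineRules (c : Code) (n : ℕ) : List verifier.Rule :=
  (leaf, encodeConfig (.normal c .halt [n])) :: evaluatorRules

/-- The variable admits every output, since only halting matters. -/
def haltPattern : verifier.Term ℕ := retTerm (encodeCont .halt) (.var 0)

theorem subst_ne_leaf_of_mem_evaluatorRules {ρ : verifier.Rule} (hρ : ρ ∈ evaluatorRules)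
    {V : Type} (σ : ℕ → verifier.Term V) : ρ.1.subst σ ≠ leaf := by
  have hnode : ∃ s t, ρ.1 = node s t := by
    simp only [evaluatorRules, List.mem_cons, List.not_mem_nil, or_false] at hρ
    rcases hρ with rfl | rfl | rfl | rfl | rfl | rfl | rfl | rfl | rfl | rfl | rfl | rfl | rfl |
      rfl | rfl | rfl | rfl | rfl <;> exact ⟨_, _, rfl⟩
  obtain ⟨s, t, e⟩ := hnode
  rw [e, subst_node]
  exact node_ne_leaf _ _

theorem machineStep_encodeConfig {c : Code} {n : ℕ} {x y : Config} (hxy : x.Step y) :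
    MachineStep (machineRules c n) (encodeConfig x) (encodeConfig y) := by
  obtain ⟨ρ, hρ, σ, hx, hy⟩ := exists_evaluatorRule hxy
  exact ⟨plain_encodeConfig y, ρ, .tail _ hρ, σ, hx, hy⟩

/-- No configuration is encoded as `leaf`, so the initial rule fires only at the start, and every
later step is one of the evaluator. -/
theorem config_reach_of_machine {c : Code} {n : ℕ} {t : verifier.GroundTerm}
    (ht : ReflTransGen (MachineStep (machineRules c n)) leaf t) :
    t = leaf ∨ ∃ x, t = encodeConfig x ∧
      ReflTransGen Config.Step (.normal c .halt [n]) x := by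
  induction ht with
  | refl => exact .inl rfl
  | tail _ hs ih =>
    right
    obtain ⟨-, ρ, hρ, σ, hl, rfl⟩ := hs
    rcases List.mem_cons.1 hρ with rfl | hρ
    · rcases ih with rfl | ⟨x, rfl, -⟩
      · exact ⟨_, subst_encodeConfig σ (.normal c .halt [n]), .refl⟩
      · exact absurd (hl.symm.trans (subst_leaf σ)) (encodeConfig_ne_leaf x)
    · rcases ih with rfl | ⟨x, rfl, hr⟩
      · exact absurd hl (subst_ne_leaf_of_mem_evaluatorRules hρ σ)
      · obtain ⟨y, hy, e⟩ := config_step_of_rule hρ hl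
        exact ⟨y, e, hr.tail hy⟩

theorem accepts_iff_dom (c : Code) (n : ℕ) :
    Accepts (machineRules c n) haltPattern ↔ (c.eval [n]).Dom := by
  rw [Config.eval_dom_iff]
  constructor
  · rintro ⟨σ, hσ⟩
    rcases config_reach_of_machine hσ with e | ⟨x, e, hr⟩
    · simp [haltPattern, retTerm] at e
    · rcases x with ⟨c', k, v⟩ | ⟨k, v⟩
      · simp [haltPattern, retTerm, encodeConfig, normalTerm] at e
      · cases k with
        | halt => exact ⟨v, hr⟩
        | _ => simp [haltPattern, retTerm, encodeConfig, encodeCont] at e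
  · rintro ⟨w, hr⟩
    refine ⟨fun _ => encodeList w, .head ⟨plain_encodeConfig _, _, List.mem_cons_self ..,
      fun _ => leaf, subst_leaf _, subst_encodeConfig _ (.normal c .halt [n])⟩ ?_⟩
    have e : haltPattern.subst (fun _ => encodeList w) =
        (encodeConfig (.ret .halt w) : verifier.GroundTerm) := by
      simp [haltPattern, retTerm, encodeConfig]
    rw [e]
    exact hr.lift (p := MachineStep (machineRules c n)) encodeConfig
      fun _ _ => machineStep_encodeConfig

/-! ### Computability of the reduction -/

section Codes

theorem code_app {F : RankedAlphabet} (f : Fin F.size) (ts : Fin (F.rank f) → F.Term ℕ) :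
    (Term.app f ts).code = Sum.inr (f : ℕ) :: (List.ofFn fun i => (ts i).code).flatten := by
  simp only [Term.code]

theorem code_leaf : (leaf : verifier.Term ℕ).code = [Sum.inr 0] := code_app _ _

theorem code_node (s t : verifier.Term ℕ) :
    (node s t).code = Sum.inr 4 :: (s.code ++ t.code) :=
  (code_app _ _).trans (congrArg (List.cons _)
    (show [s.code, t.code].flatten = s.code ++ t.code by simp))

theorem code_check (s t u : verifier.Term ℕ) :
    (check s t u).code = Sum.inr 6 :: (s.code ++ (t.code ++ u.code)) :=
  (code_app _ _).trans (congrArg (List.cons _)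
    (show [s.code, t.code, u.code].flatten = s.code ++ (t.code ++ u.code) by simp))

theorem primrec_code_num : Primrec fun n => (num n : verifier.Term ℕ).code := by
  have hstep : Primrec₂ fun (_ : ℕ) (l : List (ℕ ⊕ ℕ)) => Sum.inr 4 :: Sum.inr 0 :: l :=
    Primrec.list_cons.comp₂ (Primrec₂.const _)
      (Primrec.list_cons.comp₂ (Primrec₂.const _) Primrec₂.right)
  refine (Primrec.nat_rec₁ [Sum.inr 0] hstep).of_eq fun n => ?_
  induction n with
  | zero => exact code_leaf.symm
  | succ n ih =>
    rw [num, code_node, code_leaf]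
    simp only [ih]
    rfl

/-- The input enters only as one numeral inside one left-hand side; everything around it is
constant. -/
theorem code_initial (c : Code) : ∃ pre post : List (ℕ ⊕ ℕ), ∀ n,
    (historyRule (leaf, encodeConfig (.normal c .halt [n]))).1.code =
      pre ++ ((num n : verifier.Term ℕ).code ++ post) := by
  -- The last `Sum.inr 4` of the prefix opens the list `[n]`, and the first `Sum.inr 0` of the
  -- suffix closes it.
  refine ⟨Sum.inr 6 :: Sum.inr 0 :: Sum.inr 4 :: Sum.inr 4 :: ((num 0 : verifier.Term ℕ).code ++
    Sum.inr 4 :: ((encodeCode c : verifier.Term ℕ).code ++ Sum.inr 4 ::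
      ((encodeCont .halt : verifier.Term ℕ).code ++ [Sum.inr 4]))),
    Sum.inr 0 :: ((Term.var 0 : verifier.Term ℕ).code ++
      (node (.var 1) (.var 2) : verifier.Term ℕ).code), fun n => ?_⟩
  simp only [historyRule, shift, subst_encodeConfig, subst_leaf]
  simp only [encodeConfig, normalTerm, tagged, encodeList, code_check, code_node, code_leaf]
  simp

theorem primrec_instanceCode (c : Code) : Primrec fun n =>
    verifier.instanceCode (systemRules (machineRules c n) haltPattern) := by
  obtain ⟨pre, post, hcode⟩ := code_initial c
  have hlhs : Primrec fun n => pre ++ ((num n : verifier.Term ℕ).code ++ post) :=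
    Primrec.list_append.comp (Primrec.const _)
      (Primrec.list_append.comp primrec_code_num (Primrec.const _))
  let ruleCode : verifier.Rule → List (ℕ ⊕ ℕ) × List (ℕ ⊕ ℕ) := fun ρ => (ρ.1.code, ρ.2.code)
  refine ((Primrec.const (List.ofFn verifier.rank)).pair (Primrec.list_cons.comp
    (Primrec.const (ruleCode (start (.var 0) (.var 0), check leaf (.var 0) (.var 0))))
    (Primrec.list_cons.comp
      (hlhs.pair (Primrec.const (check (.var 1) (.var 2) (.var 2) : verifier.Term ℕ).code))
      (Primrec.const ((evaluatorRules.map historyRule ++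
        rightGroundRules haltPattern).map ruleCode))))).of_eq fun n => ?_
  rw [← hcode]
  rfl

end Codes

/-- A `Code` for the universal function "evaluate the program numbered `n` at `0`" has the halting
problem as its domain. -/
theorem exists_code_dom_not_computable :
    ∃ c : Code, ¬ ComputablePred fun n : ℕ => (c.eval [n]).Dom := by
  have hf : Partrec fun n : ℕ => (Denumerable.ofNat Nat.Partrec.Code n).eval 0 :=
    Nat.Partrec.Code.eval_part.comp (Computable.ofNat _) (Computable.const 0)
  obtain ⟨c, hc⟩ := Code.exists_code (Nat.Partrec'.part_iff₁.2 hf)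
  refine ⟨c, fun hcomp => ComputablePred.halting_problem 0 ?_⟩
  obtain ⟨g, hg, e⟩ := ComputablePred.computable_iff.1 hcomp
  refine ComputablePred.computable_iff.2
    ⟨fun d => g (Encodable.encode d), hg.comp Computable.encode, funext fun d => ?_⟩
  have hd := congrFun e (Encodable.encode d)
  have hv := hc ⟨[Encodable.encode d], rfl⟩
  change c.eval [Encodable.encode d] = _ at hv
  rw [← hd, hv]
  change _ = ((Denumerable.ofNat Nat.Partrec.Code (Encodable.encode d)).eval 0).Dom
  rw [Denumerable.ofNat_encode]

end verifier

end RankedAlphabet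

/-- No computable predicate on inputs answers correctly, on every listing of the rules of every
murg TRS `R` over every ranked alphabet `F`, whether `R` preserves `F`-recognizability of finite
tree languages. -/
theorem mainTheorem10 :
    ¬ ∃ P : RankedAlphabet.InstanceCode → Prop, ComputablePred P ∧
      ∀ (F : RankedAlphabet) (R : F.TRS) (rs : List F.Rule),
        (∀ ρ, ρ ∈ rs ↔ ρ ∈ R.rules) → R.IsMurg →
          (P (F.instanceCode rs) ↔ R.PreservesFiniteRecognizability) := by
  rintro ⟨P, hP, hspec⟩
  obtain ⟨c, hc⟩ := RankedAlphabet.verifier.exists_code_dom_not_computable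
  obtain ⟨g, hg, rfl⟩ := ComputablePred.computable_iff.1 hP
  refine hc (ComputablePred.computable_iff.2
    ⟨_, hg.comp (RankedAlphabet.verifier.primrec_instanceCode c).to_comp,
      funext fun n => propext ?_⟩)
  rw [← RankedAlphabet.verifier.accepts_iff_dom, ← RankedAlphabet.verifier.preserves_iff_accepts]
  exact (hspec RankedAlphabet.verifier (RankedAlphabet.verifier.system _ _) _ (fun ρ => Iff.rfl)
    (RankedAlphabet.verifier.system_isMurg _ _)).symm
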